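/- **Channel.** A memoryless interference channel with unilateral source cooperation has finite input alphabets $\mathcal X_1,\mathcal X_2$, finite output alphabets $\mathcal Y_{F2},\mathcal Y_1,\mathcal Y_2$ and a transition probability $P_{Y_{F2},Y_1,Y_2|X_1,X_2}$. For block length $N$, the messages $W_u$, $u\in\{1,2\}$, are independent and uniform on $\{m\in\mathbb Z: 1\le m\le 2^{NR_u}\}$. At time $i$ transmitter 1 sends $X_{1i}(W_1)$ and transmitter 2 sends $X_{2i}(W_2,Y_{F2}^{i-1})$, where $Y_{F2}^{i-1}$ are its past channel observations. Receiver $u$ forms the estimate $\widehat W_u(Y_u^N)$. A pair $(R_1,R_2)$ with $R_1,R_2\ge 0$ is achievable if for every $\epsilon>0$ and all sufficiently large $N$ there is a code with $\max_u \mathbb P[\widehat W_u\ne W_u]\le\epsilon$; the capacity region is the closure of the set of achievable pairs. **Theorem.** Suppose that there are finite alphabets $\mathcal Y_f,\mathcal T_1,\mathcal T_2$, transition probabilities $P_{Y_f,T_1|X_1}$, $P_{T_2|X_2}$, and functions $f_1:\mathcal X_1\times\mathcal T_2\to\mathcal Y_1$, $f_2:\mathcal X_2\times\mathcal T_1\to\mathcal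 Y_2$, $f_3:\mathcal X_2\times\mathcal Y_f\to\mathcal Y_{F2}$, each injective in its second argument when the first is fixed, such that $$P_{Y_{F2},Y_1,Y_2|X_1,X_2}(y_F,y_1,y_2|x_1,x_2)=\sum_{a,b,c}P_{Y_f,T_1|X_1}(a,b|x_1)\,P_{T_2|X_2}(c|x_2)\,\mathbf 1\{y_1=f_1(x_1,c)\}\,\mathbf 1\{y_2=f_2(x_2,b)\}\,\mathbf 1\{y_F=f_3(x_2,a)\}.$$ Then for every $(R_1,R_2)$ in the capacity region there is an input distribution $P_{X_1,X_2}$ such that, with entropies in bits computed under $P_{X_1,X_2}P_{Y_f,T_1|X_1}P_{T_2|X_2}$ and with $Y_1=f_1(X_1,T_2)$, $Y_2=f_2(X_2,T_1)$, both of the following hold: $$\begin{aligned}2R_1+R_2\le{}& H(Y_1)-H(Y_1|X_1,X_2)+H(Y_1|T_1,Y_f,X_2)-H(Y_1|T_1,Y_f,X_1,X_2)\\&+H(Y_2|T_2,Y_f)-H(Y_2|T_2,Y_f,X_1,X_2)+I(Y_f;X_1,X_2|T_2),\end{aligned}$$ $$\begin{aligned}R_1+2R_2\le{}& H(Y_2)-H(Y_2|X_1,X_2)+H(Y_2|T_2,Y_f,X_1)-H(Y_2|T_2,Y_f,X_1,X_2)\\&+H(Y_1,Y_f|T_1)-H(Y_1,Y_f|X_1,X_2,T_1).\end{aligned}$$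 -/

import Mathlib

open Filter Topology

/-! Entropy (in bits) of discrete random variables, for a finite sample space `Ω` with
probability mass function `p : Ω → ℝ`. A random variable is a function on `Ω`. -/

namespace FiniteEntropy

variable {Ω α β γ : Type*} [Fintype Ω] [Fintype α] [Fintype β] [Fintype γ]

open Classical in
/-- The probability mass function of the random variable `X`. -/
noncomputable def pmfOf (p : Ω → ℝ) (X : Ω → α) (a : α) : ℝ :=
  ∑ ω, if X ω = a then p ω else 0

/-- `H(X) = -∑ P(x) log₂ P(x)`. -/
noncomputable def entropy (p : Ω → ℝ) (X : Ω → α) : ℝ :=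
  -∑ a, pmfOf p X a * Real.logb 2 (pmfOf p X a)

/-- `H(X | Y) = -∑ P(x, y) log₂ (P(x, y) / P(y))`. -/
noncomputable def condEntropy (p : Ω → ℝ) (X : Ω → α) (Y : Ω → β) : ℝ :=
  -∑ a, ∑ b, pmfOf p (fun ω => (X ω, Y ω)) (a, b) *
    Real.logb 2 (pmfOf p (fun ω => (X ω, Y ω)) (a, b) / pmfOf p Y b)

/-- `I(X ; Y | Z) = H(X | Z) - H(X | Y, Z)`. -/
noncomputable def condMutualInfo (p : Ω → ℝ) (X : Ω → α) (Y : Ω → β) (Z : Ω → γ) : ℝ :=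
  condEntropy p X Z - condEntropy p X (fun ω => (Y ω, Z ω))

end FiniteEntropy

/-- A memoryless interference channel with unilateral generalized feedback on finite alphabets:
a transition probability `P(yF, y₁, y₂ | x₁, x₂)`, where `yF` is the signal observed by the second
transmitter. -/
structure MemorylessIC (X₁ X₂ YF Y₁ Y₂ : Type*) [Fintype YF] [Fintype Y₁] [Fintype Y₂] where
  trans : X₁ → X₂ → YF × Y₁ × Y₂ → ℝ
  trans_mem : ∀ x₁ x₂, trans x₁ x₂ ∈ stdSimplex ℝ (YF × Y₁ × Y₂)

/-- A code of block length `N` with `M₁` and `M₂` messages. The channel input `X₁ᵢ` is a function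
of `W₁`; the input `X₂ᵢ` is a function of `W₂` and the `i - 1` past feedback symbols. -/
structure ICCode (X₁ X₂ YF Y₁ Y₂ : Type*) (N M₁ M₂ : ℕ) where
  enc₁ : Fin M₁ → Fin N → X₁
  enc₂ : Fin M₂ → (i : Fin N) → (Fin i → YF) → X₂
  dec₁ : (Fin N → Y₁) → Fin M₁
  dec₂ : (Fin N → Y₂) → Fin M₂

namespace MemorylessIC

variable {X₁ X₂ YF Y₁ Y₂ : Type*} [Fintype YF] [Fintype Y₁] [Fintype Y₂] {N M₁ M₂ : ℕ}

/-- The joint law of the messages (independent and uniform) and the `N` channel outputs. -/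
noncomputable def codeLaw (C : MemorylessIC X₁ X₂ YF Y₁ Y₂) (c : ICCode X₁ X₂ YF Y₁ Y₂ N M₁ M₂)
    (w₁ : Fin M₁) (w₂ : Fin M₂) (yF : Fin N → YF) (y₁ : Fin N → Y₁) (y₂ : Fin N → Y₂) : ℝ :=
  (1 / (M₁ : ℝ)) * (1 / (M₂ : ℝ)) *
    ∏ i : Fin N, C.trans (c.enc₁ w₁ i) (c.enc₂ w₂ i (fun j => yF (Fin.castLE i.isLt.le j)))
      (yF i, y₁ i, y₂ i)

/-- `ℙ[Ŵ₁ ≠ W₁]`. -/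
noncomputable def err₁ (C : MemorylessIC X₁ X₂ YF Y₁ Y₂)
    (c : ICCode X₁ X₂ YF Y₁ Y₂ N M₁ M₂) : ℝ :=
  ∑ w₁, ∑ w₂, ∑ yF : Fin N → YF, ∑ y₁ : Fin N → Y₁, ∑ y₂ : Fin N → Y₂,
    if c.dec₁ y₁ ≠ w₁ then C.codeLaw c w₁ w₂ yF y₁ y₂ else 0

/-- `ℙ[Ŵ₂ ≠ W₂]`. -/
noncomputable def err₂ (C : MemorylessIC X₁ X₂ YF Y₁ Y₂)
    (c : ICCode X₁ X₂ YF Y₁ Y₂ N M₁ M₂) : ℝ :=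
  ∑ w₁, ∑ w₂, ∑ yF : Fin N → YF, ∑ y₁ : Fin N → Y₁, ∑ y₂ : Fin N → Y₂,
    if c.dec₂ y₂ ≠ w₂ then C.codeLaw c w₁ w₂ yF y₁ y₂ else 0

/-- The rate pair `R` (bits per channel use) is `ε`-achievable: for all sufficiently large `N`
there is a code with message sets `{m : 1 ≤ m ≤ 2 ^ (N R_u)}` and both error probabilities at
most `ε`. -/
def EpsAchievable (C : MemorylessIC X₁ X₂ YF Y₁ Y₂) (ε : ℝ) (R : ℝ × ℝ) : Prop :=
  ∀ᶠ N : ℕ in atTop,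
    ∃ c : ICCode X₁ X₂ YF Y₁ Y₂ N ⌊(2 : ℝ) ^ ((N : ℝ) * R.1)⌋₊ ⌊(2 : ℝ) ^ ((N : ℝ) * R.2)⌋₊,
      max (C.err₁ c) (C.err₂ c) ≤ ε

/-- The capacity region: the closure of the set of non-negative rate pairs that are
`ε`-achievable for every `ε > 0`. -/
def capacityRegion (C : MemorylessIC X₁ X₂ YF Y₁ Y₂) : Set (ℝ × ℝ) :=
  closure {R | 0 ≤ R.1 ∧ 0 ≤ R.2 ∧ ∀ ε : ℝ, 0 < ε → C.EpsAchievable ε R}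

end MemorylessIC

/-- The data of an injective semi-deterministic interference channel with unilateral source
cooperation: transition probabilities `P(yf, t₁ | x₁)` and `P(t₂ | x₂)`, and deterministic maps
`y₁ = f₁(x₁, t₂)`, `y₂ = f₂(x₂, t₁)`, `yF = f₃(x₂, yf)`, each injective for a given channel
input. -/
structure ISDModel (X₁ X₂ YF Y₁ Y₂ Yf T₁ T₂ : Type*) [Fintype Yf] [Fintype T₁] [Fintype T₂] where
  noise₁ : X₁ → Yf × T₁ → ℝ
  noise₁_mem : ∀ x₁, noise₁ x₁ ∈ stdSimplex ℝ (Yf × T₁)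
  noise₂ : X₂ → T₂ → ℝ
  noise₂_mem : ∀ x₂, noise₂ x₂ ∈ stdSimplex ℝ T₂
  f₁ : X₁ → T₂ → Y₁
  f₁_inj : ∀ x₁, Function.Injective (f₁ x₁)
  f₂ : X₂ → T₁ → Y₂
  f₂_inj : ∀ x₂, Function.Injective (f₂ x₂)
  f₃ : X₂ → Yf → YF
  f₃_inj : ∀ x₂, Function.Injective (f₃ x₂)

namespace ISDModel

open FiniteEntropy

variable {X₁ X₂ YF Y₁ Y₂ Yf T₁ T₂ : Type*} [Fintype X₁] [Fintype X₂] [Fintype YF] [Fintype Y₁]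
  [Fintype Y₂] [Fintype Yf] [Fintype T₁] [Fintype T₂]

open Classical in
/-- The transition probability of the channel `C` is the one given by the model `S`. -/
def Represents (S : ISDModel X₁ X₂ YF Y₁ Y₂ Yf T₁ T₂) (C : MemorylessIC X₁ X₂ YF Y₁ Y₂) : Prop :=
  ∀ x₁ x₂ yF y₁ y₂, C.trans x₁ x₂ (yF, y₁, y₂) =
    ∑ a : Yf, ∑ b : T₁, ∑ c : T₂, S.noise₁ x₁ (a, b) * S.noise₂ x₂ c *
      (if y₁ = S.f₁ x₁ c then 1 else 0) * (if y₂ = S.f₂ x₂ b then 1 else 0) *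
      (if yF = S.f₃ x₂ a then 1 else 0)

/-- The joint law of `(X₁, X₂, Yf, T₁, T₂)` for the input distribution `P`. -/
noncomputable def law (S : ISDModel X₁ X₂ YF Y₁ Y₂ Yf T₁ T₂) (P : X₁ × X₂ → ℝ) :
    X₁ × X₂ × Yf × T₁ × T₂ → ℝ :=
  fun (x₁, x₂, yf, t₁, t₂) => P (x₁, x₂) * S.noise₁ x₁ (yf, t₁) * S.noise₂ x₂ t₂

/-- The outer bound on `2 R₁ + R₂` at the input distribution `P`. -/
noncomputable def bound₂₁ (S : ISDModel X₁ X₂ YF Y₁ Y₂ Yf T₁ T₂) (P : X₁ × X₂ → ℝ) : ℝ :=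
  let p := S.law P
  let vX₁ : X₁ × X₂ × Yf × T₁ × T₂ → X₁ := fun (x₁, _, _, _, _) => x₁
  let vX₂ : X₁ × X₂ × Yf × T₁ × T₂ → X₂ := fun (_, x₂, _, _, _) => x₂
  let vYf : X₁ × X₂ × Yf × T₁ × T₂ → Yf := fun (_, _, yf, _, _) => yf
  let vT₁ : X₁ × X₂ × Yf × T₁ × T₂ → T₁ := fun (_, _, _, t₁, _) => t₁
  let vT₂ : X₁ × X₂ × Yf × T₁ × T₂ → T₂ := fun (_, _, _, _, t₂) => t₂
  let vY₁ : X₁ × X₂ × Yf × T₁ × T₂ → Y₁ := fun (x₁, _, _, _, t₂) => S.f₁ x₁ t₂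
  let vY₂ : X₁ × X₂ × Yf × T₁ × T₂ → Y₂ := fun (_, x₂, _, t₁, _) => S.f₂ x₂ t₁
  entropy p vY₁ - condEntropy p vY₁ (fun ω => (vX₁ ω, vX₂ ω))
    + condEntropy p vY₁ (fun ω => (vT₁ ω, vYf ω, vX₂ ω))
    - condEntropy p vY₁ (fun ω => (vT₁ ω, vYf ω, vX₁ ω, vX₂ ω))
    + condEntropy p vY₂ (fun ω => (vT₂ ω, vYf ω))
    - condEntropy p vY₂ (fun ω => (vT₂ ω, vYf ω, vX₁ ω, vX₂ ω))
    + condMutualInfo p vYf (fun ω => (vX₁ ω, vX₂ ω)) vT₂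

/-- The outer bound on `R₁ + 2 R₂` at the input distribution `P`. -/
noncomputable def bound₁₂ (S : ISDModel X₁ X₂ YF Y₁ Y₂ Yf T₁ T₂) (P : X₁ × X₂ → ℝ) : ℝ :=
  let p := S.law P
  let vX₁ : X₁ × X₂ × Yf × T₁ × T₂ → X₁ := fun (x₁, _, _, _, _) => x₁
  let vX₂ : X₁ × X₂ × Yf × T₁ × T₂ → X₂ := fun (_, x₂, _, _, _) => x₂
  let vYf : X₁ × X₂ × Yf × T₁ × T₂ → Yf := fun (_, _, yf, _, _) => yf
  let vT₁ : X₁ × X₂ × Yf × T₁ × T₂ → T₁ := fun (_, _, _, t₁, _) => t₁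
  let vT₂ : X₁ × X₂ × Yf × T₁ × T₂ → T₂ := fun (_, _, _, _, t₂) => t₂
  let vY₁ : X₁ × X₂ × Yf × T₁ × T₂ → Y₁ := fun (x₁, _, _, _, t₂) => S.f₁ x₁ t₂
  let vY₂ : X₁ × X₂ × Yf × T₁ × T₂ → Y₂ := fun (_, x₂, _, t₁, _) => S.f₂ x₂ t₁
  entropy p vY₂ - condEntropy p vY₂ (fun ω => (vX₁ ω, vX₂ ω))
    + condEntropy p vY₂ (fun ω => (vT₂ ω, vYf ω, vX₁ ω))
    - condEntropy p vY₂ (fun ω => (vT₂ ω, vYf ω, vX₁ ω, vX₂ ω))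
    + condEntropy p (fun ω => (vY₁ ω, vYf ω)) vT₁
    - condEntropy p (fun ω => (vY₁ ω, vYf ω)) (fun ω => (vX₁ ω, vX₂ ω, vT₁ ω))

end ISDModel

/-! The converse is genie-aided. Write U, V, A, B, C for the blocks of Y₁, Y₂, Yf, T₁, T₂. By Fano's
inequality and independence of the messages, N(2R₁ + R₂) is, up to a small multiple of N, at most
I(W₁; U) + I(W₁; U, B, A | W₂) + I(W₂; V, C, A), and N(R₁ + 2R₂) is at most I(W₂; V) + I(W₂; V, C, A
| W₁) + I(W₁; U, A, B) (`fano`, `le_gains`). One copy of a receiver works unaided; the others are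
given noise blocks, and sometimes the other message.

These sums are single-letterised by induction on time: one more channel use raises each by at most
the single-letter bound at the current input law (`gain₂₁_le`, `gain₁₂_le`). Injectivity of f₁ and
f₂ makes U equivalent to C given W₁, and V equivalent to B given W₂ and A, so noise terms
conditioned on the past occur with both signs. They cancel by the Markov chain (W₁, B) − A − (W₂,
C). That chain survives every channel use, because transmitter 2 learns about transmitter 1 only
through Yf. The remaining negative terms are entropies of the current noises given the current
inputs.

The average over time of the single-letter bounds is at most the bound at the averaged input law
(`sum_bound₂₁_le`, `sum_bound₁₂_le`): the noises depend on the time index only through the inputs.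
The same averaged law serves both inequalities. Compactness of the simplex and continuity of the
bounds then remove the slack.

Entropy depends only on the partition of the sample space into level sets. All information
inequalities are therefore instances of `ent_submod`, whose side conditions are functional
dependences, and they are combined linearly. -/

namespace FiniteEntropy

/-! ### Entropy of partitions and its submodularity -/

section Calculus

variable {Ω Ω' α β γ δ ι : Type*} [Fintype Ω] [Fintype Ω']

/-- The random variable `(X, Y)`. -/
def joint (X : Ω → α) (Y : Ω → β) : Ω → α × β := fun ω => (X ω, Y ω)

infixr:67 " ⋈ " => joint

omit [Fintype Ω] in
theorem joint_eq_iff {X : Ω → α} {Y : Ω → β} {ω ω' : Ω} :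
    (X ⋈ Y) ω = (X ⋈ Y) ω' ↔ X ω = X ω' ∧ Y ω = Y ω' :=
  Prod.mk.injEq _ _ _ _ ▸ Iff.rfl

open Classical in
/-- The probability of the event that `X` takes the value which it takes at `ω`. -/
noncomputable def cellMass (p : Ω → ℝ) (X : Ω → α) (ω : Ω) : ℝ :=
  ∑ ω', if X ω' = X ω then p ω' else 0

/-- The entropy of `X` in bits, as an expectation. -/
noncomputable def ent (p : Ω → ℝ) (X : Ω → α) : ℝ :=
  -∑ ω, p ω * Real.logb 2 (cellMass p X ω)

theorem cellMass_nonneg {p : Ω → ℝ} (hp : ∀ ω, 0 ≤ p ω) (X : Ω → α) (ω : Ω) :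
    0 ≤ cellMass p X ω :=
  Finset.sum_nonneg fun ω' _ => by split_ifs <;> simp [hp]

theorem le_cellMass {p : Ω → ℝ} (hp : ∀ ω, 0 ≤ p ω) (X : Ω → α) (ω : Ω) :
    p ω ≤ cellMass p X ω := by
  classical
  have := Finset.single_le_sum (f := fun ω' => if X ω' = X ω then p ω' else 0)
    (fun ω' _ => by split_ifs <;> simp [hp]) (Finset.mem_univ ω)
  simpa [cellMass] using this

theorem cellMass_pos {p : Ω → ℝ} (hp : ∀ ω, 0 ≤ p ω) (X : Ω → α) {ω : Ω} (h : 0 < p ω) :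
    0 < cellMass p X ω :=
  h.trans_le (le_cellMass hp X ω)

theorem cellMass_anti {p : Ω → ℝ} (hp : ∀ ω, 0 ≤ p ω) {X : Ω → α} {Y : Ω → β}
    (h : ∀ ω ω', X ω = X ω' → Y ω = Y ω') (ω : Ω) : cellMass p X ω ≤ cellMass p Y ω := by
  refine Finset.sum_le_sum fun ω' _ => ?_
  by_cases hX : X ω' = X ω
  · simp [hX, h _ _ hX]
  · simp only [hX, if_false]; split_ifs <;> simp [hp]

theorem cellMass_congr {p : Ω → ℝ} {X : Ω → α} {ω ω' : Ω} (h : X ω = X ω') :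
    cellMass p X ω = cellMass p X ω' := by
  unfold cellMass
  rw [h]

theorem ent_mono {p : Ω → ℝ} (hp : ∀ ω, 0 ≤ p ω) {X : Ω → α} {Y : Ω → β}
    (h : ∀ ω ω', X ω = X ω' → Y ω = Y ω') : ent p Y ≤ ent p X := by
  refine neg_le_neg (Finset.sum_le_sum fun ω _ => ?_)
  rcases (hp ω).eq_or_lt with h0 | h0
  · simp [← h0]
  · exact mul_le_mul_of_nonneg_left (Real.logb_le_logb_of_le (by norm_num)
      (cellMass_pos hp X h0) (cellMass_anti hp h ω)) h0.le

theorem ent_congr {p : Ω → ℝ} {X : Ω → α} {Y : Ω → β}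
    (h : ∀ ω ω', X ω = X ω' ↔ Y ω = Y ω') : ent p X = ent p Y := by
  have hc : cellMass p X = cellMass p Y :=
    funext fun ω => by classical exact Finset.sum_congr rfl fun ω' _ => if_congr (h _ _) rfl rfl
  simp only [ent, hc]

theorem cellMass_comp {q : Ω' → ℝ} {p : Ω → ℝ} {π : Ω' → Ω}
    (hπ : ∀ f : Ω → ℝ, ∑ ω', q ω' * f (π ω') = ∑ ω, p ω * f ω) (X : Ω → α) (ω' : Ω') :
    cellMass q (fun ω' => X (π ω')) ω' = cellMass p X (π ω') := by
  classical
  have := hπ fun ω => if X ω = X (π ω') then 1 else 0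
  simpa [cellMass] using this

/-- Push-forwards preserve entropies. -/
theorem ent_comp {q : Ω' → ℝ} {p : Ω → ℝ} {π : Ω' → Ω}
    (hπ : ∀ f : Ω → ℝ, ∑ ω', q ω' * f (π ω') = ∑ ω, p ω * f ω) (X : Ω → α) :
    ent q (fun ω' => X (π ω')) = ent p X := by
  simp only [ent, cellMass_comp hπ]
  rw [hπ fun ω => Real.logb 2 (cellMass p X ω)]

theorem logb_sub_logb_le {a b : ℝ} (ha : 0 < a) (hb : 0 < b) :
    Real.logb 2 a - Real.logb 2 b ≤ (a / b - 1) / Real.log 2 := by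
  rw [← Real.logb_div ha.ne' hb.ne', Real.logb]
  have := Real.log_le_sub_one_of_pos (div_pos ha hb)
  have h2 : 0 < Real.log 2 := Real.log_pos (by norm_num)
  gcongr

/-- Expand the two cell masses in the numerator as sums over points σ and τ. For fixed σ, τ the sum
over ω runs over one cell of `S ⋈ T`, whose mass cancels the denominator, leaving at most p σ · p τ
/ P(I σ) with I τ = I σ. Summing over τ cancels P(I σ). -/
theorem sum_cellMass_ratio_le {p : Ω → ℝ} (hp : ∀ ω, 0 ≤ p ω) {S : Ω → α} {T : Ω → β}
    {I : Ω → γ} (hS : ∀ ω ω', S ω = S ω' → I ω = I ω') (hT : ∀ ω ω', T ω = T ω' → I ω = I ω') :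
    ∑ ω, p ω * ((cellMass p S ω * cellMass p T ω) /
      (cellMass p (S ⋈ T) ω * cellMass p I ω)) ≤ ∑ ω, p ω := by
  classical
  have key : ∀ σ τ, ∑ ω, (if S σ = S ω then p σ else 0) * (if T τ = T ω then p τ else 0) *
      (p ω / (cellMass p (S ⋈ T) ω * cellMass p I ω)) ≤
      (if I τ = I σ then p τ else 0) * (p σ / cellMass p I σ) := by
    intro σ τ
    have hr : 0 ≤ (if I τ = I σ then p τ else 0) * (p σ / cellMass p I σ) :=
      mul_nonneg (by split_ifs <;> simp [hp]) (div_nonneg (hp _) (cellMass_nonneg hp _ _))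
    by_cases hex : ∃ ω₀, S σ = S ω₀ ∧ T τ = T ω₀
    · obtain ⟨ω₀, h1, h2⟩ := hex
      have hI : I τ = I σ := (hT _ _ h2).trans (hS _ _ h1).symm
      have hterm : ∀ ω, (if S σ = S ω then p σ else 0) * (if T τ = T ω then p τ else 0) *
          (p ω / (cellMass p (S ⋈ T) ω * cellMass p I ω)) =
          (if (S ⋈ T) ω = (S ⋈ T) ω₀ then p ω else 0) *
            (p τ * (p σ / cellMass p I σ) / cellMass p (S ⋈ T) ω₀) := by
        intro ω
        by_cases hs : S σ = S ω
        · by_cases ht : T τ = T ω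
          · have hj : (S ⋈ T) ω = (S ⋈ T) ω₀ := by simp [joint, ← hs, ← ht, h1, h2]
            rw [if_pos hs, if_pos ht, if_pos hj, cellMass_congr (p := p) hj,
              ← cellMass_congr (p := p) (hS _ _ hs)]
            ring
          · have hj : ¬ (S ⋈ T) ω = (S ⋈ T) ω₀ := by
              simp only [joint, Prod.mk.injEq, not_and]; intro _ h; exact ht (h2.trans h.symm)
            simp [ht, hj]
        · have hj : ¬ (S ⋈ T) ω = (S ⋈ T) ω₀ := by
            simp only [joint, Prod.mk.injEq, not_and]; intro h; exact absurd (h1.trans h.symm) hs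
          simp [hs, hj]
      simp only [hterm, ← Finset.sum_mul]
      rw [if_pos hI] at hr ⊢
      have hc : ∑ i, (if (S ⋈ T) i = (S ⋈ T) ω₀ then p i else 0) = cellMass p (S ⋈ T) ω₀ := by
        unfold cellMass
        congr!
      rw [hc]
      rcases (cellMass_nonneg hp (S ⋈ T) ω₀).eq_or_lt with h0 | h0
      · rw [← h0]; simpa using hr
      · rw [mul_div_cancel₀ _ h0.ne']
    · push Not at hex
      refine le_trans (le_of_eq (Finset.sum_eq_zero fun ω _ => ?_)) hr
      by_cases hs : S σ = S ω
      · simp [hex ω hs]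
      · simp [hs]
  calc _ = ∑ ω, ∑ σ, ∑ τ, (if S σ = S ω then p σ else 0) * (if T τ = T ω then p τ else 0) *
      (p ω / (cellMass p (S ⋈ T) ω * cellMass p I ω)) := by
        refine Finset.sum_congr rfl fun ω _ => ?_
        simp only [← Finset.sum_mul, ← Finset.mul_sum]
        simp only [cellMass]
        ring
    _ = ∑ σ, ∑ τ, ∑ ω, (if S σ = S ω then p σ else 0) * (if T τ = T ω then p τ else 0) *
      (p ω / (cellMass p (S ⋈ T) ω * cellMass p I ω)) := by
        rw [Finset.sum_comm]
        exact Finset.sum_congr rfl fun σ _ => Finset.sum_comm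
    _ ≤ ∑ σ, ∑ τ, (if I τ = I σ then p τ else 0) * (p σ / cellMass p I σ) :=
        Finset.sum_le_sum fun σ _ => Finset.sum_le_sum fun τ _ => key σ τ
    _ ≤ ∑ σ, p σ := by
        refine Finset.sum_le_sum fun σ _ => ?_
        rw [← Finset.sum_mul]
        change cellMass p I σ * _ ≤ _
        rcases (hp σ).eq_or_lt with h0 | h0
        · simp [← h0]
        · rw [mul_div_cancel₀ _ (cellMass_pos hp I h0).ne']

/-- Submodularity of entropy, in terms of functional dependence. -/
theorem ent_submod {p : Ω → ℝ} (hp : ∀ ω, 0 ≤ p ω) (S : Ω → α) (T : Ω → β) (I : Ω → γ)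
    (J : Ω → δ) (hS : ∀ ω ω', S ω = S ω' → I ω = I ω') (hT : ∀ ω ω', T ω = T ω' → I ω = I ω')
    (hJ : ∀ ω ω', S ω = S ω' → T ω = T ω' → J ω = J ω') :
    ent p J + ent p I ≤ ent p S + ent p T := by
  have h1 : ent p J ≤ ent p (S ⋈ T) := ent_mono hp fun ω ω' h => by
    simp only [joint, Prod.mk.injEq] at h
    exact hJ _ _ h.1 h.2
  -- Non-negativity of conditional mutual information through log x ≤ x − 1, applied only at points
  -- of positive mass, where all four cells have positive mass.
  have h2 : ∑ ω, p ω * (Real.logb 2 (cellMass p S ω) + Real.logb 2 (cellMass p T ω) -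
      Real.logb 2 (cellMass p (S ⋈ T) ω) - Real.logb 2 (cellMass p I ω)) ≤
      (∑ ω, p ω * ((cellMass p S ω * cellMass p T ω) /
      (cellMass p (S ⋈ T) ω * cellMass p I ω)) - ∑ ω, p ω) / Real.log 2 := by
    rw [← Finset.sum_sub_distrib, Finset.sum_div]
    refine Finset.sum_le_sum fun ω _ => ?_
    rcases (hp ω).eq_or_lt with h0 | h0
    · simp [← h0]
    · have a1 := cellMass_pos hp S h0
      have a2 := cellMass_pos hp T h0
      have a3 := cellMass_pos hp (S ⋈ T) h0
      have a4 := cellMass_pos hp I h0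
      have := logb_sub_logb_le (mul_pos a1 a2) (mul_pos a3 a4)
      rw [Real.logb_mul a1.ne' a2.ne', Real.logb_mul a3.ne' a4.ne'] at this
      calc _ ≤ p ω * (((cellMass p S ω * cellMass p T ω) /
          (cellMass p (S ⋈ T) ω * cellMass p I ω) - 1) / Real.log 2) := by
            refine mul_le_mul_of_nonneg_left ?_ h0.le
            linarith
        _ = _ := by ring
  have h3 : (∑ ω, p ω * ((cellMass p S ω * cellMass p T ω) /
      (cellMass p (S ⋈ T) ω * cellMass p I ω)) - ∑ ω, p ω) / Real.log 2 ≤ 0 :=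
    div_nonpos_of_nonpos_of_nonneg (by linarith [sum_cellMass_ratio_le hp hS hT])
      (Real.log_nonneg (by norm_num))
  have h4 := h2.trans h3
  simp only [mul_sub, mul_add, Finset.sum_sub_distrib, Finset.sum_add_distrib] at h4
  unfold ent at *
  linarith

theorem pmfOf_eq_cellMass [Fintype α] (p : Ω → ℝ) (X : Ω → α) (ω : Ω) :
    pmfOf p X (X ω) = cellMass p X ω := rfl

theorem sum_pmfOf_mul [Fintype α] (p : Ω → ℝ) (X : Ω → α) (f : α → ℝ) :
    ∑ a, pmfOf p X a * f a = ∑ ω, p ω * f (X ω) := by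
  classical
  simp only [pmfOf, Finset.sum_mul]
  rw [Finset.sum_comm]
  refine Finset.sum_congr rfl fun ω _ => ?_
  simp [ite_mul]

theorem entropy_eq_ent [Fintype α] (p : Ω → ℝ) (X : Ω → α) : entropy p X = ent p X := by
  rw [entropy, sum_pmfOf_mul p X fun a => Real.logb 2 (pmfOf p X a)]
  rfl

theorem condEntropy_eq_ent [Fintype α] [Fintype β] {p : Ω → ℝ} (hp : ∀ ω, 0 ≤ p ω) (X : Ω → α)
    (Y : Ω → β) : condEntropy p X Y = ent p (X ⋈ Y) - ent p Y := by
  have h : condEntropy p X Y = -∑ c : α × β, pmfOf p (X ⋈ Y) c *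
      Real.logb 2 (pmfOf p (X ⋈ Y) c / pmfOf p Y c.2) := by
    rw [condEntropy, Fintype.sum_prod_type]; rfl
  rw [h, sum_pmfOf_mul p (X ⋈ Y) fun c => Real.logb 2 (pmfOf p (X ⋈ Y) c / pmfOf p Y c.2)]
  simp only [ent]
  rw [← neg_add', neg_inj, ← sub_eq_add_neg, ← Finset.sum_sub_distrib]
  refine Finset.sum_congr rfl fun ω _ => ?_
  rcases (hp ω).eq_or_lt with h0 | h0
  · simp [← h0]
  · rw [pmfOf_eq_cellMass]
    change p ω * Real.logb 2 (cellMass p (X ⋈ Y) ω / cellMass p Y ω) = _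
    rw [Real.logb_div (cellMass_pos hp _ h0).ne' (cellMass_pos hp _ h0).ne']
    ring

end Calculus

end FiniteEntropy

namespace FiniteEntropy

/-! ### Memoryless noise, Fano's inequality, mixtures and uniform messages -/

section Kernels

variable {Ω α β ζ₁ ζ₂ ξ₁ ξ₂ ι : Type*} [Fintype Ω] [Fintype ζ₁] [Fintype ζ₂]

theorem cellMass_of_injective (p : Ω → ℝ) {X : Ω → α} (hX : Function.Injective X) (ω : Ω) :
    cellMass p X ω = p ω := by
  classical
  simp [cellMass, hX.eq_iff]

/-- The law of `(ω, z₁, z₂)` where `z₁`, `z₂` are drawn independently given `ω`. -/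
def kernelLaw (p : Ω → ℝ) (x₁ : Ω → ξ₁) (n₁ : ξ₁ → ζ₁ → ℝ) (x₂ : Ω → ξ₂) (n₂ : ξ₂ → ζ₂ → ℝ) :
    Ω × ζ₁ × ζ₂ → ℝ :=
  fun w => p w.1 * n₁ (x₁ w.1) w.2.1 * n₂ (x₂ w.1) w.2.2

variable {p : Ω → ℝ} {x₁ : Ω → ξ₁} {n₁ : ξ₁ → ζ₁ → ℝ} {x₂ : Ω → ξ₂} {n₂ : ξ₂ → ζ₂ → ℝ}

theorem sum_kernelLaw_mul (h₁ : ∀ x, n₁ x ∈ stdSimplex ℝ ζ₁) (h₂ : ∀ x, n₂ x ∈ stdSimplex ℝ ζ₂)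
    (f : Ω → ℝ) :
    ∑ w, kernelLaw p x₁ n₁ x₂ n₂ w * f w.1 = ∑ ω, p ω * f ω := by
  simp only [Fintype.sum_prod_type, kernelLaw]
  refine Finset.sum_congr rfl fun ω _ => ?_
  simp only [← Finset.mul_sum, ← Finset.sum_mul, (h₁ _).2, (h₂ _).2, mul_one]

theorem cellMass_kernelLaw_left (h₂ : ∀ x, n₂ x ∈ stdSimplex ℝ ζ₂) (w : Ω × ζ₁ × ζ₂) :
    cellMass (kernelLaw p x₁ n₁ x₂ n₂) (fun w => (w.2.1, x₁ w.1)) w =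
      n₁ (x₁ w.1) w.2.1 * cellMass p x₁ w.1 := by
  classical
  simp only [cellMass, Fintype.sum_prod_type, kernelLaw, Finset.mul_sum, Prod.mk.injEq]
  refine Finset.sum_congr rfl fun ω _ => ?_
  by_cases hx : x₁ ω = x₁ w.1
  · simp only [hx, and_true, if_true]
    rw [Finset.sum_eq_single w.2.1]
    · simp only [if_true, ← Finset.mul_sum, (h₂ _).2]; ring
    · intro b _ hb; simp [hb]
    · simp
  · simp [hx]

theorem cellMass_kernelLaw_right (h₁ : ∀ x, n₁ x ∈ stdSimplex ℝ ζ₁) (w : Ω × ζ₁ × ζ₂) :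
    cellMass (kernelLaw p x₁ n₁ x₂ n₂) (fun w => (w.2.2, x₂ w.1)) w =
      n₂ (x₂ w.1) w.2.2 * cellMass p x₂ w.1 := by
  classical
  simp only [cellMass, Fintype.sum_prod_type, kernelLaw, Finset.mul_sum, Prod.mk.injEq]
  refine Finset.sum_congr rfl fun ω _ => ?_
  by_cases hx : x₂ ω = x₂ w.1
  · rw [Finset.sum_comm]
    simp only [hx, and_true, if_true]
    rw [Finset.sum_eq_single w.2.2]
    · simp only [if_true, ← Finset.mul_sum, ← Finset.sum_mul, (h₁ _).2]; ring
    · intro b _ hb; simp [hb]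
    · simp
  · simp [hx]

/-- The noises `z₁` and `z₂` depend on the past only through `x₁` and `x₂`. -/
theorem ent_kernelLaw (h₁ : ∀ x, n₁ x ∈ stdSimplex ℝ ζ₁) (h₂ : ∀ x, n₂ x ∈ stdSimplex ℝ ζ₂)
    (hp : ∀ ω, 0 ≤ p ω) :
    ent (kernelLaw p x₁ n₁ x₂ n₂) (fun w => (w.2.1, x₁ w.1)) -
        ent (kernelLaw p x₁ n₁ x₂ n₂) (fun w => x₁ w.1) +
      (ent (kernelLaw p x₁ n₁ x₂ n₂) (fun w => (w.2.2, x₂ w.1)) -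
        ent (kernelLaw p x₁ n₁ x₂ n₂) (fun w => x₂ w.1)) +
      ent (kernelLaw p x₁ n₁ x₂ n₂) (fun w => w.1) =
    ent (kernelLaw p x₁ n₁ x₂ n₂) (fun w => w) := by
  set q := kernelLaw p x₁ n₁ x₂ n₂ with hq
  have hπ := sum_kernelLaw_mul (p := p) (x₁ := x₁) (x₂ := x₂) h₁ h₂
  -- The identity holds pointwise on the support of `q`: there log q splits into the logarithms of
  -- p, n₁ and n₂, and each kernel value is a ratio of cell masses.
  have key : ∀ w, q w * (Real.logb 2 (cellMass q (fun w => w) w)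
      - Real.logb 2 (cellMass q (fun w => (w.2.1, x₁ w.1)) w)
      + Real.logb 2 (cellMass q (fun w => x₁ w.1) w)
      - Real.logb 2 (cellMass q (fun w => (w.2.2, x₂ w.1)) w)
      + Real.logb 2 (cellMass q (fun w => x₂ w.1) w)
      - Real.logb 2 (cellMass q (fun w => w.1) w)) = 0 := by
    intro w
    rw [cellMass_kernelLaw_left h₂, cellMass_kernelLaw_right h₁,
      cellMass_comp hπ x₁, cellMass_comp hπ x₂, cellMass_comp hπ fun ω => ω,
      cellMass_of_injective p fun _ _ h => h, cellMass_of_injective q fun _ _ h => h]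
    have e : q w = p w.1 * n₁ (x₁ w.1) w.2.1 * n₂ (x₂ w.1) w.2.2 := rfl
    by_cases h0 : q w = 0
    · simp [h0]
    have ha : p w.1 ≠ 0 := fun h => h0 (by simp [e, h])
    have hb : n₁ (x₁ w.1) w.2.1 ≠ 0 := fun h => h0 (by simp [e, h])
    have hc : n₂ (x₂ w.1) w.2.2 ≠ 0 := fun h => h0 (by simp [e, h])
    have hpos : 0 < p w.1 := lt_of_le_of_ne (hp _) ha.symm
    rw [e, Real.logb_mul (mul_ne_zero ha hb) hc, Real.logb_mul ha hb,
      Real.logb_mul hb (cellMass_pos hp _ hpos).ne', Real.logb_mul hc (cellMass_pos hp _ hpos).ne']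
    ring
  have := Finset.sum_congr rfl fun w (_ : w ∈ Finset.univ) => key w
  simp only [mul_sub, mul_add, Finset.sum_sub_distrib, Finset.sum_add_distrib,
    Finset.sum_const_zero] at this
  unfold ent
  linarith

/-- A weak form of Fano's inequality. -/
theorem fano (hp : ∀ ω, 0 ≤ p ω) (hp1 : ∑ ω, p ω = 1) {M : ℕ} (W : Ω → Fin M) (Y : Ω → β)
    (dec : β → Fin M) :
    ent p (W ⋈ Y) - ent p Y ≤
      1 + (∑ ω, if dec (Y ω) ≠ W ω then p ω else 0) * Real.logb 2 M := by
  classical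
  rcases Nat.eq_zero_or_pos M with hM | hM
  · subst hM
    exfalso
    have : IsEmpty Ω := ⟨fun ω => (W ω).elim0⟩
    simp at hp1
  have hM' : (0 : ℝ) < M := by exact_mod_cast hM
  -- A trial conditional law for Gibbs' inequality: half the mass on the decoded message, half
  -- spread uniformly. Then −log₂ r is at most 1 when decoding succeeds and equals 1 + log₂ M when
  -- it fails.
  set r : Fin M → β → ℝ := fun w y => (if w = dec y then 1 / 2 else 0) + 1 / (2 * M) with hr
  have hrpos : ∀ w y, 0 < r w y := fun w y => by
    have : (0 : ℝ) ≤ if w = dec y then 1 / 2 else 0 := by split_ifs <;> norm_num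
    have h2 : (0 : ℝ) < 1 / (2 * M) := by positivity
    simp only [hr]; linarith
  have hrsum : ∀ y, ∑ w, r w y = 1 := fun y => by
    simp only [hr, Finset.sum_add_distrib, Finset.sum_ite_eq', Finset.mem_univ, if_true]
    simp
    field_simp
    norm_num
  have gibbs : ∑ ω, p ω * (cellMass p Y ω * r (W ω) (Y ω) / cellMass p (W ⋈ Y) ω) ≤ 1 := by
    have hin : ∀ σ, ∑ ω, (if Y σ = Y ω then p σ else 0) *
        (p ω * r (W ω) (Y ω) / cellMass p (W ⋈ Y) ω) ≤ p σ := by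
      intro σ
      have hw : ∀ w, ∑ ω, (if W ω = w then (if Y σ = Y ω then p σ else 0) *
          (p ω * r (W ω) (Y ω) / cellMass p (W ⋈ Y) ω) else 0) ≤ p σ * r w (Y σ) := by
        intro w
        have hnn : 0 ≤ p σ * r w (Y σ) := mul_nonneg (hp _) (hrpos _ _).le
        by_cases hex : ∃ ω₀, W ω₀ = w ∧ Y σ = Y ω₀
        · obtain ⟨ω₀, e1, e2⟩ := hex
          have ht : ∀ ω, (if W ω = w then (if Y σ = Y ω then p σ else 0) *
              (p ω * r (W ω) (Y ω) / cellMass p (W ⋈ Y) ω) else 0) =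
              (if (W ⋈ Y) ω = (W ⋈ Y) ω₀ then p ω else 0) *
                (p σ * r w (Y σ) / cellMass p (W ⋈ Y) ω₀) := by
            intro ω
            by_cases c1 : W ω = w
            · by_cases c2 : Y σ = Y ω
              · have hj : (W ⋈ Y) ω = (W ⋈ Y) ω₀ := by simp [joint, c1, ← c2, e1, e2]
                rw [if_pos c1, if_pos c2, if_pos hj, cellMass_congr (p := p) hj, c1, c2]
                ring
              · have hj : ¬ (W ⋈ Y) ω = (W ⋈ Y) ω₀ := by
                  simp only [joint, Prod.mk.injEq, not_and]
                  intro _ h; exact c2 (e2.trans h.symm)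
                simp [c2, hj]
            · have hj : ¬ (W ⋈ Y) ω = (W ⋈ Y) ω₀ := by
                simp only [joint, Prod.mk.injEq, not_and]
                intro h; exact absurd (h.trans e1) c1
              simp [c1, hj]
          have hc : ∑ i, (if (W ⋈ Y) i = (W ⋈ Y) ω₀ then p i else 0) = cellMass p (W ⋈ Y) ω₀ := by
            unfold cellMass
            congr!
          simp only [ht, ← Finset.sum_mul]
          rw [hc]
          rcases (cellMass_nonneg hp (W ⋈ Y) ω₀).eq_or_lt with h0 | h0
          · rw [← h0]; simpa using hnn
          · rw [mul_div_cancel₀ _ h0.ne']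
        · push Not at hex
          refine le_trans (le_of_eq (Finset.sum_eq_zero fun ω _ => ?_)) hnn
          by_cases c1 : W ω = w
          · simp [hex ω c1]
          · simp [c1]
      calc _ = ∑ w, ∑ ω, (if W ω = w then (if Y σ = Y ω then p σ else 0) *
          (p ω * r (W ω) (Y ω) / cellMass p (W ⋈ Y) ω) else 0) := by
            rw [Finset.sum_comm]; simp
        _ ≤ ∑ w, p σ * r w (Y σ) := Finset.sum_le_sum fun w _ => hw w
        _ = p σ := by rw [← Finset.mul_sum, hrsum, mul_one]
    calc _ = ∑ ω, ∑ σ, (if Y σ = Y ω then p σ else 0) *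
        (p ω * r (W ω) (Y ω) / cellMass p (W ⋈ Y) ω) := by
          refine Finset.sum_congr rfl fun ω _ => ?_
          rw [← Finset.sum_mul]
          simp only [cellMass]
          ring_nf
      _ ≤ ∑ σ, p σ := by rw [Finset.sum_comm]; exact Finset.sum_le_sum fun σ _ => hin σ
      _ = 1 := hp1
  have hlog2 : (0 : ℝ) < Real.log 2 := Real.log_pos (by norm_num)
  have h2 : ∑ ω, p ω * (Real.logb 2 (cellMass p Y ω) + Real.logb 2 (r (W ω) (Y ω)) -
      Real.logb 2 (cellMass p (W ⋈ Y) ω)) ≤ 0 := by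
    calc _ ≤ ∑ ω, (p ω * (cellMass p Y ω * r (W ω) (Y ω) / cellMass p (W ⋈ Y) ω) - p ω)
          / Real.log 2 := by
          refine Finset.sum_le_sum fun ω _ => ?_
          rcases (hp ω).eq_or_lt with h0 | h0
          · simp [← h0]
          · have a1 := cellMass_pos hp Y h0
            have a3 := cellMass_pos hp (W ⋈ Y) h0
            have := logb_sub_logb_le (mul_pos a1 (hrpos (W ω) (Y ω))) a3
            rw [Real.logb_mul a1.ne' (hrpos _ _).ne'] at this
            calc _ ≤ p ω * ((cellMass p Y ω * r (W ω) (Y ω) / cellMass p (W ⋈ Y) ω - 1)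
                / Real.log 2) := mul_le_mul_of_nonneg_left this h0.le
              _ = _ := by ring
      _ ≤ 0 := by
          rw [← Finset.sum_div, Finset.sum_sub_distrib, hp1]
          exact div_nonpos_of_nonpos_of_nonneg (by linarith) hlog2.le
  have h3 : ∑ ω, p ω * -Real.logb 2 (r (W ω) (Y ω)) ≤
      ∑ ω, (p ω + (if dec (Y ω) ≠ W ω then p ω else 0) * Real.logb 2 M) := by
    refine Finset.sum_le_sum fun ω _ => ?_
    by_cases hd : dec (Y ω) = W ω
    · have : Real.logb 2 (1 / 2) ≤ Real.logb 2 (r (W ω) (Y ω)) := by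
        refine Real.logb_le_logb_of_le (by norm_num) (by norm_num) ?_
        simp only [hr, hd, if_true]
        have h2 : (0 : ℝ) < 1 / (2 * M) := by positivity
        linarith
      rw [one_div, Real.logb_inv, Real.logb_self_eq_one (by norm_num)] at this
      simp only [hd, ne_eq, not_true, if_false, zero_mul, add_zero]
      nlinarith [hp ω]
    · have : r (W ω) (Y ω) = 1 / (2 * M) := by simp [hr, Ne.symm hd]
      rw [this, one_div, Real.logb_inv, Real.logb_mul (by norm_num) hM'.ne',
        Real.logb_self_eq_one (by norm_num), if_pos hd]
      linarith
  rw [Finset.sum_add_distrib, hp1, ← Finset.sum_mul] at h3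
  simp only [mul_sub, mul_add, mul_neg, Finset.sum_neg_distrib, Finset.sum_sub_distrib,
    Finset.sum_add_distrib] at h2 h3
  unfold ent
  linarith

/-- The entropy of a mixture, jointly with the mixing variable. -/
theorem ent_mixture [Fintype ι] [Nonempty ι] {p : ι → Ω → ℝ} (hp : ∀ i ω, 0 ≤ p i ω)
    (hp1 : ∀ i, ∑ ω, p i ω = 1) (X : Ω → α) :
    ent (fun w : ι × Ω => p w.1 w.2 / Fintype.card ι) (fun w => (w.1, X w.2)) =
      Real.logb 2 (Fintype.card ι) + (∑ i, ent (p i) X) / Fintype.card ι := by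
  classical
  have hN : (Fintype.card ι : ℝ) ≠ 0 := by simp
  have hc : ∀ w : ι × Ω, cellMass (fun w : ι × Ω => p w.1 w.2 / Fintype.card ι)
      (fun w => (w.1, X w.2)) w = cellMass (p w.1) X w.2 / Fintype.card ι := by
    intro w
    simp only [cellMass, Fintype.sum_prod_type, Prod.mk.injEq, Finset.sum_div]
    rw [Finset.sum_eq_single w.1]
    · refine Finset.sum_congr rfl fun ω _ => ?_
      by_cases h : X ω = X w.2 <;> simp [h]
    · intro i _ hi; simp [hi]
    · simp
  simp only [ent, hc, Fintype.sum_prod_type]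
  have : ∀ i, ∑ ω, p i ω / Fintype.card ι *
      Real.logb 2 (cellMass (p i) X ω / Fintype.card ι) =
      (∑ ω, p i ω * Real.logb 2 (cellMass (p i) X ω)) / Fintype.card ι -
        Real.logb 2 (Fintype.card ι) / Fintype.card ι := by
    intro i
    have h1 : Real.logb 2 (Fintype.card ι) / Fintype.card ι =
        ∑ ω, p i ω * (Real.logb 2 (Fintype.card ι) / Fintype.card ι) := by
      rw [← Finset.sum_mul, hp1, one_mul]
    rw [h1, Finset.sum_div, ← Finset.sum_sub_distrib]
    refine Finset.sum_congr rfl fun ω _ => ?_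
    rcases (hp i ω).eq_or_lt with h0 | h0
    · simp [← h0]
    · rw [Real.logb_div (cellMass_pos (hp i) _ h0).ne' hN]; ring
  simp only [this, Finset.sum_sub_distrib, Finset.sum_const, Finset.card_univ, nsmul_eq_mul,
    Finset.sum_neg_distrib, ← Finset.sum_div]
  field_simp
  ring

theorem ent_uniform_prod {M₁ M₂ : ℕ} (h₁ : 0 < M₁) (h₂ : 0 < M₂) :
    ent (fun _ : Fin M₁ × Fin M₂ => 1 / (M₁ : ℝ) * (1 / (M₂ : ℝ))) Prod.fst = Real.logb 2 M₁ ∧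
    ent (fun _ : Fin M₁ × Fin M₂ => 1 / (M₁ : ℝ) * (1 / (M₂ : ℝ))) Prod.snd = Real.logb 2 M₂ ∧
    ent (fun _ : Fin M₁ × Fin M₂ => 1 / (M₁ : ℝ) * (1 / (M₂ : ℝ))) id =
      Real.logb 2 M₁ + Real.logb 2 M₂ := by
  have e₁ : (M₁ : ℝ) ≠ 0 := by exact_mod_cast h₁.ne'
  have e₂ : (M₂ : ℝ) ≠ 0 := by exact_mod_cast h₂.ne'
  have hu : ∀ M : ℕ, 0 < M → ent (fun _ : Fin M => 1 / (M : ℝ)) id = Real.logb 2 M := by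
    intro M hM
    have e : (M : ℝ) ≠ 0 := by exact_mod_cast hM.ne'
    simp only [ent, cellMass_of_injective _ Function.injective_id, Finset.sum_const,
      Finset.card_univ, Fintype.card_fin, nsmul_eq_mul, one_div, Real.logb_inv]
    field_simp
  refine ⟨?_, ?_, ?_⟩
  · refine (ent_comp (p := fun _ : Fin M₁ => 1 / (M₁ : ℝ)) (π := Prod.fst) (fun f => ?_)
      id).trans (hu M₁ h₁)
    simp only [Fintype.sum_prod_type, Finset.sum_const, Finset.card_univ, Fintype.card_fin,
      nsmul_eq_mul]
    refine Finset.sum_congr rfl fun a _ => ?_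
    field_simp
  · refine (ent_comp (p := fun _ : Fin M₂ => 1 / (M₂ : ℝ)) (π := Prod.snd) (fun f => ?_)
      id).trans (hu M₂ h₂)
    rw [Fintype.sum_prod_type_right]
    simp only [Finset.sum_const, Finset.card_univ, Fintype.card_fin, nsmul_eq_mul]
    refine Finset.sum_congr rfl fun a _ => ?_
    field_simp
  · simp only [ent, cellMass_of_injective _ Function.injective_id, Finset.sum_const,
      Finset.card_univ, Fintype.card_prod, Fintype.card_fin,
      nsmul_eq_mul, Nat.cast_mul, one_div]
    rw [Real.logb_mul (inv_ne_zero e₁) (inv_ne_zero e₂), Real.logb_inv, Real.logb_inv]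
    field_simp
    ring

end Kernels

end FiniteEntropy

namespace FiniteEntropy

/-! ### The single-letter expressions and time sharing -/

section SingleLetter

variable {Ω α β γ ι 𝒲₁ 𝒲₂ 𝒜 ℬ 𝒞 𝒰 𝒱 𝒜' ℬ' 𝒞' 𝒰' 𝒱' χ₁ χ₂ θf θ₁ θ₂ η₁ η₂ : Type*} [Fintype Ω]

/-- The expression of the bound on `2 R₁ + R₂`, conditioned on `Q`. -/
noncomputable def single₂₁ (p : Ω → ℝ) (Q : Ω → ι) (x₁ : Ω → χ₁) (x₂ : Ω → χ₂) (a : Ω → θf)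
    (b : Ω → θ₁) (c : Ω → θ₂) (y₁ : Ω → η₁) (y₂ : Ω → η₂) : ℝ :=
  (ent p (Q ⋈ y₁) - ent p Q) - (ent p (Q ⋈ y₁ ⋈ x₁ ⋈ x₂) - ent p (Q ⋈ x₁ ⋈ x₂))
    + (ent p (Q ⋈ y₁ ⋈ b ⋈ a ⋈ x₂) - ent p (Q ⋈ b ⋈ a ⋈ x₂))
    - (ent p (Q ⋈ y₁ ⋈ b ⋈ a ⋈ x₁ ⋈ x₂) - ent p (Q ⋈ b ⋈ a ⋈ x₁ ⋈ x₂))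
    + (ent p (Q ⋈ y₂ ⋈ c ⋈ a) - ent p (Q ⋈ c ⋈ a))
    - (ent p (Q ⋈ y₂ ⋈ c ⋈ a ⋈ x₁ ⋈ x₂) - ent p (Q ⋈ c ⋈ a ⋈ x₁ ⋈ x₂))
    + ((ent p (Q ⋈ a ⋈ c) - ent p (Q ⋈ c))
      - (ent p (Q ⋈ a ⋈ (x₁ ⋈ x₂) ⋈ c) - ent p (Q ⋈ (x₁ ⋈ x₂) ⋈ c)))

/-- The expression of the bound on `R₁ + 2 R₂`, conditioned on `Q`. -/
noncomputable def single₁₂ (p : Ω → ℝ) (Q : Ω → ι) (x₁ : Ω → χ₁) (x₂ : Ω → χ₂) (a : Ω → θf)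
    (b : Ω → θ₁) (c : Ω → θ₂) (y₁ : Ω → η₁) (y₂ : Ω → η₂) : ℝ :=
  (ent p (Q ⋈ y₂) - ent p Q) - (ent p (Q ⋈ y₂ ⋈ x₁ ⋈ x₂) - ent p (Q ⋈ x₁ ⋈ x₂))
    + (ent p (Q ⋈ y₂ ⋈ c ⋈ a ⋈ x₁) - ent p (Q ⋈ c ⋈ a ⋈ x₁))
    - (ent p (Q ⋈ y₂ ⋈ c ⋈ a ⋈ x₁ ⋈ x₂) - ent p (Q ⋈ c ⋈ a ⋈ x₁ ⋈ x₂))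
    + (ent p (Q ⋈ (y₁ ⋈ a) ⋈ b) - ent p (Q ⋈ b))
    - (ent p (Q ⋈ (y₁ ⋈ a) ⋈ x₁ ⋈ x₂ ⋈ b) - ent p (Q ⋈ x₁ ⋈ x₂ ⋈ b))

/-- The trivial random variable. -/
def triv : Ω → Unit := fun _ => ()

theorem ent_triv {p : Ω → ℝ} (hp1 : ∑ ω, p ω = 1) : ent p triv = 0 := by
  simp [ent, cellMass, triv, hp1]

theorem ent_triv_joint (p : Ω → ℝ) (X : Ω → α) : ent p (triv ⋈ X) = ent p X :=
  ent_congr fun ω ω' => by simp [joint, triv]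

variable {p : Ω → ℝ} (hp : ∀ ω, 0 ≤ p ω) {Q : Ω → ι} {x₁ : Ω → χ₁} {x₂ : Ω → χ₂} {a : Ω → θf}
  {b : Ω → θ₁} {c : Ω → θ₂} {y₁ : Ω → η₁} {y₂ : Ω → η₂}
  (hy₁ : ∀ ω ω', x₁ ω = x₁ ω' → (y₁ ω = y₁ ω' ↔ c ω = c ω'))
  (hy₂ : ∀ ω ω', x₂ ω = x₂ ω' → (y₂ ω = y₂ ω' ↔ b ω = b ω'))

include hp hy₁ hy₂

/-- Given x₁ and x₂, the outputs y₁ and y₂ amount to c and b, and dropping conditioning bounds the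
subtracted entropies by H(c|x₂), again H(c|x₂), and H(a,b|x₁). No Markov property is needed, so the
bound serves both the time recursion and time sharing. -/
theorem le_single₂₁ (hp1 : ∑ ω, p ω = 1) :
    ent p y₁ + (ent p (y₁ ⋈ b ⋈ a ⋈ x₂) - ent p (b ⋈ a ⋈ x₂)) + (ent p (y₂ ⋈ c ⋈ a) - ent p c)
      - 2 * (ent p (c ⋈ x₂) - ent p x₂) - (ent p ((a ⋈ b) ⋈ x₁) - ent p x₁) ≤
    single₂₁ p triv x₁ x₂ a b c y₁ y₂ := by
  have key :
      (ent p (y₁ ⋈ x₁ ⋈ x₂) + ent p x₂ ≤ ent p (x₁ ⋈ x₂) + ent p (c ⋈ x₂)) ∧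
      (ent p (y₁ ⋈ b ⋈ a ⋈ x₁ ⋈ x₂) + ent p x₂ ≤
        ent p (b ⋈ a ⋈ x₁ ⋈ x₂) + ent p (c ⋈ x₂)) ∧
      (ent p (y₂ ⋈ c ⋈ a ⋈ x₁ ⋈ x₂) + ent p x₁ ≤
        ent p ((x₁ ⋈ x₂) ⋈ c) + ent p ((a ⋈ b) ⋈ x₁)) := by
    refine ⟨ent_submod hp _ _ _ _ ?_ ?_ ?_, ent_submod hp _ _ _ _ ?_ ?_ ?_,
      ent_submod hp _ _ _ _ ?_ ?_ ?_⟩ <;> intro ω ω' <;>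
      (try simp only [joint_eq_iff]) <;> grind [triv]
  have e₁ : ent p (a ⋈ (x₁ ⋈ x₂) ⋈ c) = ent p (c ⋈ a ⋈ x₁ ⋈ x₂) :=
    ent_congr fun ω ω' => by simp only [joint_eq_iff]; grind [triv]
  have e₂ : ent p (c ⋈ a) = ent p (a ⋈ c) :=
    ent_congr fun ω ω' => by simp only [joint_eq_iff]; grind [triv]
  simp only [single₂₁, ent_triv_joint, ent_triv hp1]
  linarith [key.1, key.2.1, key.2.2]

/-- The subtracted entropies are bounded by H(b|x₁), H(b|a,x₁) and H(a|b,x₁) + H(c|x₂). The terms in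
(b, x₁) alone cancel, which leaves 2H(a,b|x₁) − H(a|x₁) + H(c|x₂). -/
theorem le_single₁₂ (hp1 : ∑ ω, p ω = 1) :
    ent p y₂ + (ent p (y₂ ⋈ c ⋈ a ⋈ x₁) - ent p (c ⋈ a ⋈ x₁))
      + (ent p ((y₁ ⋈ a) ⋈ b) - ent p b) - 2 * ent p ((a ⋈ b) ⋈ x₁) + ent p x₁ + ent p (a ⋈ x₁)
      - (ent p (c ⋈ x₂) - ent p x₂) ≤
    single₁₂ p triv x₁ x₂ a b c y₁ y₂ := by
  have key :
      (ent p (y₂ ⋈ x₁ ⋈ x₂) + ent p x₁ ≤ ent p (x₁ ⋈ x₂) + ent p (b ⋈ x₁)) ∧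
      (ent p (y₂ ⋈ c ⋈ a ⋈ x₁ ⋈ x₂) + ent p (a ⋈ x₁) ≤
        ent p (c ⋈ a ⋈ x₁ ⋈ x₂) + ent p ((a ⋈ b) ⋈ x₁)) ∧
      (ent p ((y₁ ⋈ a) ⋈ x₁ ⋈ x₂ ⋈ b) + ent p x₂ ≤
        ent p (a ⋈ x₁ ⋈ x₂ ⋈ b) + ent p (c ⋈ x₂)) ∧
      (ent p (a ⋈ x₁ ⋈ x₂ ⋈ b) + ent p (b ⋈ x₁) ≤
        ent p (x₁ ⋈ x₂ ⋈ b) + ent p ((a ⋈ b) ⋈ x₁)) := by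
    refine ⟨ent_submod hp _ _ _ _ ?_ ?_ ?_, ent_submod hp _ _ _ _ ?_ ?_ ?_,
      ent_submod hp _ _ _ _ ?_ ?_ ?_, ent_submod hp _ _ _ _ ?_ ?_ ?_⟩ <;> intro ω ω' <;>
      (try simp only [joint_eq_iff]) <;> grind [triv]
  simp only [single₁₂, ent_triv_joint, ent_triv hp1]
  linarith [key.1, key.2.1, key.2.2.1, key.2.2.2]

/-- Conditioning on the time-sharing variable decreases the bound on `2 R₁ + R₂`. -/
theorem single₂₁_cond_le (hp1 : ∑ ω, p ω = 1)
    (hK : (ent p ((a ⋈ b) ⋈ x₁) - ent p x₁) + (ent p (c ⋈ x₂) - ent p x₂)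
      + ent p (Q ⋈ x₁ ⋈ x₂) ≤ ent p (Q ⋈ x₁ ⋈ x₂ ⋈ a ⋈ b ⋈ c)) :
    single₂₁ p Q x₁ x₂ a b c y₁ y₂ ≤ single₂₁ p triv x₁ x₂ a b c y₁ y₂ := by
  refine le_trans ?_ (le_single₂₁ hp hy₁ hy₂ hp1)
  -- The first three inequalities remove Q from the conditioning of the positive terms. The last
  -- three, with `hK`, bound the subtracted entropies from below by noise entropies free of Q, which
  -- are those of `le_single₂₁`.
  have pos :
      (ent p (Q ⋈ y₁) + ent p triv ≤ ent p Q + ent p y₁) ∧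
      (ent p (Q ⋈ y₁ ⋈ b ⋈ a ⋈ x₂) + ent p (b ⋈ a ⋈ x₂) ≤
        ent p (Q ⋈ b ⋈ a ⋈ x₂) + ent p (y₁ ⋈ b ⋈ a ⋈ x₂)) ∧
      (ent p (Q ⋈ y₂ ⋈ c ⋈ a) + ent p c ≤ ent p (Q ⋈ c) + ent p (y₂ ⋈ c ⋈ a)) ∧
      (ent p (Q ⋈ x₁ ⋈ x₂ ⋈ a ⋈ b ⋈ c) + ent p x₁ ≤
        ent p (Q ⋈ y₁ ⋈ x₁ ⋈ x₂) + ent p ((a ⋈ b) ⋈ x₁)) ∧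
      (ent p (Q ⋈ b ⋈ a ⋈ x₁ ⋈ x₂) + ent p x₁ ≤
        ent p (Q ⋈ x₁ ⋈ x₂) + ent p ((a ⋈ b) ⋈ x₁)) ∧
      (ent p (Q ⋈ (x₁ ⋈ x₂) ⋈ c) + ent p x₂ ≤ ent p (Q ⋈ x₁ ⋈ x₂) + ent p (c ⋈ x₂)) := by
    refine ⟨ent_submod hp _ _ _ _ ?_ ?_ ?_, ent_submod hp _ _ _ _ ?_ ?_ ?_,
      ent_submod hp _ _ _ _ ?_ ?_ ?_, ent_submod hp _ _ _ _ ?_ ?_ ?_,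
      ent_submod hp _ _ _ _ ?_ ?_ ?_, ent_submod hp _ _ _ _ ?_ ?_ ?_⟩ <;> intro ω ω' <;>
      (try simp only [joint_eq_iff]) <;> grind [triv]
  have e₁ : ent p (Q ⋈ a ⋈ (x₁ ⋈ x₂) ⋈ c) = ent p (Q ⋈ c ⋈ a ⋈ x₁ ⋈ x₂) :=
    ent_congr fun ω ω' => by simp only [joint_eq_iff]; grind [triv]
  have e₂ : ent p (Q ⋈ c ⋈ a) = ent p (Q ⋈ a ⋈ c) :=
    ent_congr fun ω ω' => by simp only [joint_eq_iff]; grind [triv]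
  have e₃ : ent p (Q ⋈ y₁ ⋈ b ⋈ a ⋈ x₁ ⋈ x₂) = ent p (Q ⋈ x₁ ⋈ x₂ ⋈ a ⋈ b ⋈ c) :=
    ent_congr fun ω ω' => by simp only [joint_eq_iff]; grind [triv]
  have e₄ : ent p (Q ⋈ y₂ ⋈ c ⋈ a ⋈ x₁ ⋈ x₂) = ent p (Q ⋈ x₁ ⋈ x₂ ⋈ a ⋈ b ⋈ c) :=
    ent_congr fun ω ω' => by simp only [joint_eq_iff]; grind [triv]
  obtain ⟨p₁, p₂, p₃, p₄, p₅, p₆⟩ := pos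
  rw [ent_triv hp1] at p₁
  simp only [single₂₁]
  linarith

/-- Conditioning on the time-sharing variable decreases the bound on `R₁ + 2 R₂`. -/
theorem single₁₂_cond_le (hp1 : ∑ ω, p ω = 1)
    (hK : (ent p ((a ⋈ b) ⋈ x₁) - ent p x₁) + (ent p (c ⋈ x₂) - ent p x₂)
      + ent p (Q ⋈ x₁ ⋈ x₂) ≤ ent p (Q ⋈ x₁ ⋈ x₂ ⋈ a ⋈ b ⋈ c)) :
    single₁₂ p Q x₁ x₂ a b c y₁ y₂ ≤ single₁₂ p triv x₁ x₂ a b c y₁ y₂ := by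
  refine le_trans ?_ (le_single₁₂ hp hy₁ hy₂ hp1)
  have pos :
      (ent p (Q ⋈ y₂) + ent p triv ≤ ent p Q + ent p y₂) ∧
      (ent p (Q ⋈ y₂ ⋈ c ⋈ a ⋈ x₁) + ent p (c ⋈ a ⋈ x₁) ≤
        ent p (Q ⋈ c ⋈ a ⋈ x₁) + ent p (y₂ ⋈ c ⋈ a ⋈ x₁)) ∧
      (ent p (Q ⋈ (y₁ ⋈ a) ⋈ b) + ent p b ≤ ent p (Q ⋈ b) + ent p ((y₁ ⋈ a) ⋈ b)) ∧
      (ent p (Q ⋈ (a ⋈ b) ⋈ x₁ ⋈ x₂) + ent p (b ⋈ x₁) ≤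
        ent p (Q ⋈ y₂ ⋈ x₁ ⋈ x₂) + ent p ((a ⋈ b) ⋈ x₁)) ∧
      (ent p (Q ⋈ x₁ ⋈ x₂ ⋈ a ⋈ b ⋈ c) + ent p x₂ ≤
        ent p (Q ⋈ (a ⋈ b) ⋈ x₁ ⋈ x₂) + ent p (c ⋈ x₂)) ∧
      (ent p (Q ⋈ c ⋈ a ⋈ x₁ ⋈ x₂) + ent p x₂ ≤
        ent p (Q ⋈ a ⋈ x₁ ⋈ x₂) + ent p (c ⋈ x₂)) ∧
      (ent p (Q ⋈ a ⋈ x₁ ⋈ x₂) + ent p x₁ ≤ ent p (Q ⋈ x₁ ⋈ x₂) + ent p (a ⋈ x₁)) ∧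
      (ent p (Q ⋈ x₁ ⋈ x₂ ⋈ b) + ent p x₁ ≤ ent p (Q ⋈ x₁ ⋈ x₂) + ent p (b ⋈ x₁)) := by
    refine ⟨ent_submod hp _ _ _ _ ?_ ?_ ?_, ent_submod hp _ _ _ _ ?_ ?_ ?_,
      ent_submod hp _ _ _ _ ?_ ?_ ?_, ent_submod hp _ _ _ _ ?_ ?_ ?_,
      ent_submod hp _ _ _ _ ?_ ?_ ?_, ent_submod hp _ _ _ _ ?_ ?_ ?_,
      ent_submod hp _ _ _ _ ?_ ?_ ?_, ent_submod hp _ _ _ _ ?_ ?_ ?_⟩ <;> intro ω ω' <;>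
      (try simp only [joint_eq_iff]) <;> grind [triv]
  have e₁ : ent p (Q ⋈ y₂ ⋈ c ⋈ a ⋈ x₁ ⋈ x₂) = ent p (Q ⋈ x₁ ⋈ x₂ ⋈ a ⋈ b ⋈ c) :=
    ent_congr fun ω ω' => by simp only [joint_eq_iff]; grind [triv]
  have e₂ : ent p (Q ⋈ (y₁ ⋈ a) ⋈ x₁ ⋈ x₂ ⋈ b) = ent p (Q ⋈ x₁ ⋈ x₂ ⋈ a ⋈ b ⋈ c) :=
    ent_congr fun ω ω' => by simp only [joint_eq_iff]; grind [triv]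
  obtain ⟨p₁, p₂, p₃, p₄, p₅, p₆, p₇, p₈⟩ := pos
  rw [ent_triv hp1] at p₁
  simp only [single₁₂]
  linarith

end SingleLetter

/-! ### One channel use: growth of the multi-letter informations -/

section Step

variable {Ω 𝒲₁ 𝒲₂ 𝒜 ℬ 𝒞 𝒰 𝒱 𝒜' ℬ' 𝒞' 𝒰' 𝒱' χ₁ χ₂ θf θ₁ θ₂ η₁ η₂ : Type*}
  {κ₁ κ₂ ρ₁ ρ₂ : Type*} [Fintype Ω]

/-- The mutual informations which bound `N (2 R₁ + R₂)`, expanded into entropies. -/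
noncomputable def gain₂₁ (p : Ω → ℝ) (W₁ : Ω → 𝒲₁) (W₂ : Ω → 𝒲₂) (A : Ω → 𝒜) (B : Ω → ℬ)
    (C : Ω → 𝒞) (U : Ω → 𝒰) (V : Ω → 𝒱) : ℝ :=
  (ent p U - ent p (U ⋈ W₁) + ent p W₁)
    + (ent p (U ⋈ B ⋈ A ⋈ W₂) - ent p W₂ - ent p (U ⋈ B ⋈ A ⋈ W₁ ⋈ W₂) + ent p (W₁ ⋈ W₂))
    + (ent p (V ⋈ C ⋈ A) - ent p (V ⋈ C ⋈ A ⋈ W₂) + ent p W₂)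

/-- The mutual informations which bound `N (R₁ + 2 R₂)`, expanded into entropies. -/
noncomputable def gain₁₂ (p : Ω → ℝ) (W₁ : Ω → 𝒲₁) (W₂ : Ω → 𝒲₂) (A : Ω → 𝒜) (B : Ω → ℬ)
    (C : Ω → 𝒞) (U : Ω → 𝒰) (V : Ω → 𝒱) : ℝ :=
  (ent p V - ent p (V ⋈ W₂) + ent p W₂)
    + (ent p (V ⋈ C ⋈ A ⋈ W₁) - ent p W₁ - ent p (V ⋈ C ⋈ A ⋈ W₁ ⋈ W₂) + ent p (W₁ ⋈ W₂))
    + (ent p (U ⋈ A ⋈ B) - ent p (U ⋈ A ⋈ B ⋈ W₁) + ent p W₁)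

/-- `L` and `R` are conditionally independent given `G`. -/
def CondIndep (p : Ω → ℝ) (L : Ω → 𝒲₁) (R : Ω → 𝒲₂) (G : Ω → 𝒜) : Prop :=
  ent p (L ⋈ G) + ent p (R ⋈ G) ≤ ent p (L ⋈ R ⋈ G) + ent p G

variable {p : Ω → ℝ}

/-- Decomposition and weak union: parts of either side may be discarded or moved into the
conditioning. -/
theorem CondIndep.of_parts {L : Ω → 𝒲₁} {R : Ω → 𝒲₂} {G : Ω → 𝒜} (hp : ∀ ω, 0 ≤ p ω)
    (h : CondIndep p L R G)
    {l : Ω → κ₁} {l' : Ω → κ₂} {r : Ω → ρ₁} {r' : Ω → ρ₂}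
    (hl : ∀ ω ω', L ω = L ω' → l ω = l ω' ∧ l' ω = l' ω')
    (hr : ∀ ω ω', R ω = R ω' → r ω = r ω' ∧ r' ω = r' ω') :
    CondIndep p l r (l' ⋈ r' ⋈ G) := by
  unfold CondIndep at *
  have key :
      (ent p (L ⋈ R ⋈ G) + ent p (l ⋈ l' ⋈ G) ≤ ent p (L ⋈ G) + ent p (l ⋈ l' ⋈ R ⋈ G)) ∧
      (ent p (l ⋈ l' ⋈ R ⋈ G) + ent p (r ⋈ r' ⋈ G) ≤
        ent p (R ⋈ G) + ent p (l ⋈ r ⋈ l' ⋈ r' ⋈ G)) ∧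
      (ent p (l ⋈ l' ⋈ r' ⋈ G) + ent p G ≤ ent p (l ⋈ l' ⋈ G) + ent p (r' ⋈ G)) ∧
      (ent p (r ⋈ l' ⋈ r' ⋈ G) + ent p (r' ⋈ G) ≤ ent p (l' ⋈ r' ⋈ G) + ent p (r ⋈ r' ⋈ G)) := by
    refine ⟨ent_submod hp _ _ _ _ ?_ ?_ ?_, ent_submod hp _ _ _ _ ?_ ?_ ?_,
      ent_submod hp _ _ _ _ ?_ ?_ ?_, ent_submod hp _ _ _ _ ?_ ?_ ?_⟩ <;> intro ω ω' <;>
      (try simp only [joint_eq_iff]) <;> grind [triv]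
  obtain ⟨p₁, p₂, p₃, p₄⟩ := key
  linarith

/-- The relations between the variables up to time `k` and those up to time `k + 1`. -/
structure IsStep (p : Ω → ℝ) (W₁ : Ω → 𝒲₁) (W₂ : Ω → 𝒲₂) (A : Ω → 𝒜) (B : Ω → ℬ) (C : Ω → 𝒞)
    (U : Ω → 𝒰) (V : Ω → 𝒱) (x₁ : Ω → χ₁) (x₂ : Ω → χ₂) (a : Ω → θf) (b : Ω → θ₁) (c : Ω → θ₂)
    (y₁ : Ω → η₁) (y₂ : Ω → η₂) (A' : Ω → 𝒜') (B' : Ω → ℬ') (C' : Ω → 𝒞') (U' : Ω → 𝒰')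
    (V' : Ω → 𝒱') : Prop where
  nonneg : ∀ ω, 0 ≤ p ω
  sum_eq_one : ∑ ω, p ω = 1
  hx₁ : ∀ ω ω', W₁ ω = W₁ ω' → x₁ ω = x₁ ω'
  hx₂ : ∀ ω ω', W₂ ω = W₂ ω' → A ω = A ω' → x₂ ω = x₂ ω'
  hU : ∀ ω ω', W₁ ω = W₁ ω' → (U ω = U ω' ↔ C ω = C ω')
  hV : ∀ ω ω', W₂ ω = W₂ ω' → A ω = A ω' → (V ω = V ω' ↔ B ω = B ω')
  hy₁ : ∀ ω ω', x₁ ω = x₁ ω' → (y₁ ω = y₁ ω' ↔ c ω = c ω')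
  hy₂ : ∀ ω ω', x₂ ω = x₂ ω' → (y₂ ω = y₂ ω' ↔ b ω = b ω')
  hA' : ∀ ω ω', A' ω = A' ω' ↔ A ω = A ω' ∧ a ω = a ω'
  hB' : ∀ ω ω', B' ω = B' ω' ↔ B ω = B ω' ∧ b ω = b ω'
  hC' : ∀ ω ω', C' ω = C' ω' ↔ C ω = C ω' ∧ c ω = c ω'
  hU' : ∀ ω ω', U' ω = U' ω' ↔ U ω = U ω' ∧ y₁ ω = y₁ ω'
  hV' : ∀ ω ω', V' ω = V' ω' ↔ V ω = V ω' ∧ y₂ ω = y₂ ω'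
  kernel : (ent p ((a ⋈ b) ⋈ x₁) - ent p x₁) + (ent p (c ⋈ x₂) - ent p x₂)
    + ent p (W₁ ⋈ W₂ ⋈ A ⋈ B ⋈ C) ≤ ent p (W₁ ⋈ W₂ ⋈ A ⋈ B ⋈ C ⋈ a ⋈ b ⋈ c)
  condIndep : CondIndep p (W₁ ⋈ B) (W₂ ⋈ C) A

namespace IsStep

variable {W₁ : Ω → 𝒲₁} {W₂ : Ω → 𝒲₂} {A : Ω → 𝒜} {B : Ω → ℬ} {C : Ω → 𝒞}
    {U : Ω → 𝒰} {V : Ω → 𝒱} {x₁ : Ω → χ₁} {x₂ : Ω → χ₂} {a : Ω → θf} {b : Ω → θ₁} {c : Ω → θ₂}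
    {y₁ : Ω → η₁} {y₂ : Ω → η₂} {A' : Ω → 𝒜'} {B' : Ω → ℬ'} {C' : Ω → 𝒞'} {U' : Ω → 𝒰'}
    {V' : Ω → 𝒱'} (h : IsStep p W₁ W₂ A B C U V x₁ x₂ a b c y₁ y₂ A' B' C' U' V')

include h

/-- The new noises are drawn independently, (a, b) from x₁ and c from x₂, and these inputs are
functions of W₁ and of (W₂, A). So (a, b) joins the left side and c the right side, with `kernel`
supplying the joint entropy. -/
theorem condIndep_mid : CondIndep p (W₁ ⋈ B ⋈ a ⋈ b) (W₂ ⋈ C ⋈ c) A := by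
  obtain ⟨hp, hp1, hx₁, hx₂, hU, hV, hy₁, hy₂, hA', hB', hC', hU', hV', hK, hCI⟩ := h
  unfold CondIndep at *
  have key :
      (ent p ((W₁ ⋈ B ⋈ a ⋈ b) ⋈ A) + ent p x₁ ≤ ent p ((W₁ ⋈ B) ⋈ A) + ent p ((a ⋈ b) ⋈ x₁)) ∧
      (ent p ((W₂ ⋈ C ⋈ c) ⋈ A) + ent p x₂ ≤ ent p ((W₂ ⋈ C) ⋈ A) + ent p (c ⋈ x₂)) := by
    refine ⟨ent_submod hp _ _ _ _ ?_ ?_ ?_, ent_submod hp _ _ _ _ ?_ ?_ ?_⟩ <;>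
      intro ω ω' <;>
      (try simp only [joint_eq_iff]) <;> grind [triv]
  have e₁ : ent p ((W₁ ⋈ B) ⋈ (W₂ ⋈ C) ⋈ A) = ent p (W₁ ⋈ W₂ ⋈ A ⋈ B ⋈ C) :=
    ent_congr fun ω ω' => by simp only [joint_eq_iff]; grind [triv]
  have e₂ : ent p ((W₁ ⋈ B ⋈ a ⋈ b) ⋈ (W₂ ⋈ C ⋈ c) ⋈ A) =
      ent p (W₁ ⋈ W₂ ⋈ A ⋈ B ⋈ C ⋈ a ⋈ b ⋈ c) :=
    ent_congr fun ω ω' => by simp only [joint_eq_iff]; grind [triv]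
  linarith [key.1, key.2]

/-- The symbol a moves from the left side into the conditioning, as the feedback past grows from A
to A'. -/
theorem condIndep_next : CondIndep p (W₁ ⋈ B') (W₂ ⋈ C') A' := by
  have hM := h.condIndep_mid
  obtain ⟨hp, hp1, hx₁, hx₂, hU, hV, hy₁, hy₂, hA', hB', hC', hU', hV', hK, hCI⟩ := h
  unfold CondIndep at *
  have key : ent p ((W₂ ⋈ C') ⋈ A') + ent p A ≤ ent p ((W₂ ⋈ C ⋈ c) ⋈ A) + ent p A' := by
    refine ent_submod hp _ _ _ _ ?_ ?_ ?_ <;> intro ω ω' <;>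
      (try simp only [joint_eq_iff]) <;> grind [triv]
  have e₁ : ent p ((W₁ ⋈ B') ⋈ A') = ent p ((W₁ ⋈ B ⋈ a ⋈ b) ⋈ A) :=
    ent_congr fun ω ω' => by simp only [joint_eq_iff]; grind [triv]
  have e₂ : ent p ((W₁ ⋈ B ⋈ a ⋈ b) ⋈ (W₂ ⋈ C ⋈ c) ⋈ A) =
      ent p ((W₁ ⋈ B') ⋈ (W₂ ⋈ C') ⋈ A') :=
    ent_congr fun ω ω' => by simp only [joint_eq_iff]; grind [triv]
  linarith

/-- Two pairs of terms involving the past cancel. By `F₁`, H(a,b|B,W₂,A), from the growth of the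
second information, is at most H(a,b|C,B,W₂,A), subtracted in the third. By `F₂`, H(c|C,A), from the
third, is at most H(c|W₁,C,A), subtracted in the first. The rest is the left side of `le_single₂₁`.
-/
theorem gain₂₁_le : gain₂₁ p W₁ W₂ A' B' C' U' V' ≤
    gain₂₁ p W₁ W₂ A B C U V + single₂₁ p triv x₁ x₂ a b c y₁ y₂ := by
  have hS := le_single₂₁ (a := a) h.nonneg h.hy₁ h.hy₂ h.sum_eq_one
  have F₁ := h.condIndep_mid.of_parts h.nonneg (l := a ⋈ b) (l' := B) (r := C) (r' := W₂)
    (fun ω ω' => by simp only [joint_eq_iff]; grind [triv]) (fun ω ω' => by simp only [joint_eq_iff]; grind [triv])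
  have F₂ := h.condIndep_mid.of_parts h.nonneg (l := W₁) (l' := triv) (r := c) (r' := C)
    (fun ω ω' => by simp only [joint_eq_iff]; grind [triv]) (fun ω ω' => by simp only [joint_eq_iff]; grind [triv])
  obtain ⟨hp, hp1, hx₁, hx₂, hU, hV, hy₁, hy₂, hA', hB', hC', hU', hV', hK, hCI⟩ := h
  unfold CondIndep at F₁ F₂
  have key :
      (ent p U' + ent p triv ≤ ent p U + ent p y₁) ∧
      (ent p ((a ⋈ b) ⋈ U ⋈ B ⋈ A ⋈ W₂) + ent p (B ⋈ W₂ ⋈ A) ≤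
        ent p (U ⋈ B ⋈ A ⋈ W₂) + ent p ((a ⋈ b) ⋈ B ⋈ W₂ ⋈ A)) ∧
      (ent p (U' ⋈ B' ⋈ A' ⋈ W₂) + ent p (b ⋈ a ⋈ x₂) ≤
        ent p ((a ⋈ b) ⋈ U ⋈ B ⋈ A ⋈ W₂) + ent p (y₁ ⋈ b ⋈ a ⋈ x₂)) ∧
      (ent p (c ⋈ V ⋈ C ⋈ A) + ent p (triv ⋈ C ⋈ A) ≤
        ent p (V ⋈ C ⋈ A) + ent p (c ⋈ triv ⋈ C ⋈ A)) ∧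
      (ent p (V' ⋈ C' ⋈ A') + ent p c ≤ ent p (c ⋈ V ⋈ C ⋈ A) + ent p (y₂ ⋈ c ⋈ a)) ∧
      (ent p (W₁ ⋈ W₂ ⋈ A ⋈ B ⋈ C ⋈ a ⋈ b ⋈ c) + ent p ((a ⋈ b) ⋈ C ⋈ B ⋈ W₂ ⋈ A) ≤
        ent p (W₁ ⋈ W₂ ⋈ A ⋈ B ⋈ C ⋈ a ⋈ b) + ent p (V' ⋈ C' ⋈ A' ⋈ W₂)) ∧
      (ent p (W₁ ⋈ W₂ ⋈ A ⋈ B ⋈ C ⋈ a ⋈ b) + ent p x₁ ≤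
        ent p (W₁ ⋈ W₂ ⋈ A ⋈ B ⋈ C) + ent p ((a ⋈ b) ⋈ x₁)) ∧
      (ent p (W₁ ⋈ c ⋈ triv ⋈ C ⋈ A) + ent p (U ⋈ W₁) ≤
        ent p (U' ⋈ W₁) + ent p (W₁ ⋈ triv ⋈ C ⋈ A)) := by
    refine ⟨ent_submod hp _ _ _ _ ?_ ?_ ?_, ent_submod hp _ _ _ _ ?_ ?_ ?_,
      ent_submod hp _ _ _ _ ?_ ?_ ?_, ent_submod hp _ _ _ _ ?_ ?_ ?_,
      ent_submod hp _ _ _ _ ?_ ?_ ?_, ent_submod hp _ _ _ _ ?_ ?_ ?_,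
      ent_submod hp _ _ _ _ ?_ ?_ ?_, ent_submod hp _ _ _ _ ?_ ?_ ?_⟩ <;> intro ω ω' <;>
      (try simp only [joint_eq_iff]) <;> grind [triv]
  have e₁ : ent p (U' ⋈ B' ⋈ A' ⋈ W₁ ⋈ W₂) = ent p (W₁ ⋈ W₂ ⋈ A ⋈ B ⋈ C ⋈ a ⋈ b ⋈ c) :=
    ent_congr fun ω ω' => by simp only [joint_eq_iff]; grind [triv]
  have e₂ : ent p (U ⋈ B ⋈ A ⋈ W₁ ⋈ W₂) = ent p (W₁ ⋈ W₂ ⋈ A ⋈ B ⋈ C) :=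
    ent_congr fun ω ω' => by simp only [joint_eq_iff]; grind [triv]
  have e₃ : ent p (V ⋈ C ⋈ A ⋈ W₂) = ent p (C ⋈ B ⋈ W₂ ⋈ A) :=
    ent_congr fun ω ω' => by simp only [joint_eq_iff]; grind [triv]
  obtain ⟨p₁, p₂, p₃, p₄, p₅, p₆, p₇, p₈⟩ := key
  rw [ent_triv hp1] at p₁
  unfold gain₂₁
  linarith

/-- Here `F₃` cancels H(b|B,A), from the growth of the third information, against H(b|W₂,B,A),
subtracted in the first. `F₄` extracts from the subtracted part of the third a term H(c|W₁,C,A),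
which cancels the one in the second. What remains is the left side of `le_single₁₂`. -/
theorem gain₁₂_le : gain₁₂ p W₁ W₂ A' B' C' U' V' ≤
    gain₁₂ p W₁ W₂ A B C U V + single₁₂ p triv x₁ x₂ a b c y₁ y₂ := by
  have hS := le_single₁₂ (a := a) h.nonneg h.hy₁ h.hy₂ h.sum_eq_one
  have F₃ := h.condIndep_mid.of_parts h.nonneg (l := b) (l' := B) (r := W₂) (r' := triv)
    (fun ω ω' => by simp only [joint_eq_iff]; grind [triv]) (fun ω ω' => by simp only [joint_eq_iff]; grind [triv])
  have F₄ := h.condIndep_mid.of_parts h.nonneg (l := a ⋈ b ⋈ B) (l' := W₁) (r := c) (r' := C)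
    (fun ω ω' => by simp only [joint_eq_iff]; grind [triv]) (fun ω ω' => by simp only [joint_eq_iff]; grind [triv])
  obtain ⟨hp, hp1, hx₁, hx₂, hU, hV, hy₁, hy₂, hA', hB', hC', hU', hV', hK, hCI⟩ := h
  unfold CondIndep at F₃ F₄
  have key :
      (ent p V' + ent p triv ≤ ent p V + ent p y₂) ∧
      (ent p (b ⋈ W₂ ⋈ B ⋈ triv ⋈ A) + ent p (V ⋈ W₂) ≤
        ent p (V' ⋈ W₂) + ent p (W₂ ⋈ B ⋈ triv ⋈ A)) ∧
      (ent p (c ⋈ V ⋈ C ⋈ A ⋈ W₁) + ent p (W₁ ⋈ C ⋈ A) ≤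
        ent p (V ⋈ C ⋈ A ⋈ W₁) + ent p (c ⋈ W₁ ⋈ C ⋈ A)) ∧
      (ent p (a ⋈ c ⋈ V ⋈ C ⋈ A ⋈ W₁) + ent p x₁ ≤
        ent p (c ⋈ V ⋈ C ⋈ A ⋈ W₁) + ent p (a ⋈ x₁)) ∧
      (ent p (V' ⋈ C' ⋈ A' ⋈ W₁) + ent p (c ⋈ a ⋈ x₁) ≤
        ent p (a ⋈ c ⋈ V ⋈ C ⋈ A ⋈ W₁) + ent p (y₂ ⋈ c ⋈ a ⋈ x₁)) ∧
      (ent p (b ⋈ U ⋈ A ⋈ B) + ent p (B ⋈ triv ⋈ A) ≤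
        ent p (U ⋈ A ⋈ B) + ent p (b ⋈ B ⋈ triv ⋈ A)) ∧
      (ent p (U' ⋈ A' ⋈ B') + ent p b ≤ ent p (b ⋈ U ⋈ A ⋈ B) + ent p ((y₁ ⋈ a) ⋈ b)) ∧
      (ent p (W₁ ⋈ W₂ ⋈ A ⋈ B ⋈ C ⋈ a ⋈ b) + ent p (U ⋈ A ⋈ B ⋈ W₁) ≤
        ent p (W₁ ⋈ W₂ ⋈ A ⋈ B ⋈ C) + ent p ((a ⋈ b ⋈ B) ⋈ W₁ ⋈ C ⋈ A)) ∧
      (ent p (W₁ ⋈ W₂ ⋈ A ⋈ B ⋈ C ⋈ a ⋈ b ⋈ c) + ent p x₂ ≤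
        ent p (W₁ ⋈ W₂ ⋈ A ⋈ B ⋈ C ⋈ a ⋈ b) + ent p (c ⋈ x₂)) := by
    refine ⟨ent_submod hp _ _ _ _ ?_ ?_ ?_, ent_submod hp _ _ _ _ ?_ ?_ ?_,
      ent_submod hp _ _ _ _ ?_ ?_ ?_, ent_submod hp _ _ _ _ ?_ ?_ ?_,
      ent_submod hp _ _ _ _ ?_ ?_ ?_, ent_submod hp _ _ _ _ ?_ ?_ ?_,
      ent_submod hp _ _ _ _ ?_ ?_ ?_, ent_submod hp _ _ _ _ ?_ ?_ ?_,
      ent_submod hp _ _ _ _ ?_ ?_ ?_⟩ <;> intro ω ω' <;>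
      (try simp only [joint_eq_iff]) <;> grind [triv]
  have e₁ : ent p (V' ⋈ C' ⋈ A' ⋈ W₁ ⋈ W₂) = ent p (W₁ ⋈ W₂ ⋈ A ⋈ B ⋈ C ⋈ a ⋈ b ⋈ c) :=
    ent_congr fun ω ω' => by simp only [joint_eq_iff]; grind [triv]
  have e₂ : ent p (V ⋈ C ⋈ A ⋈ W₁ ⋈ W₂) = ent p (W₁ ⋈ W₂ ⋈ A ⋈ B ⋈ C) :=
    ent_congr fun ω ω' => by simp only [joint_eq_iff]; grind [triv]
  have e₃ : ent p (U' ⋈ A' ⋈ B' ⋈ W₁) = ent p ((a ⋈ b ⋈ B) ⋈ c ⋈ W₁ ⋈ C ⋈ A) :=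
    ent_congr fun ω ω' => by simp only [joint_eq_iff]; grind [triv]
  obtain ⟨p₁, p₂, p₃, p₄, p₅, p₆, p₇, p₈, p₉⟩ := key
  rw [ent_triv hp1] at p₁
  unfold gain₁₂
  linarith

end IsStep

end Step

end FiniteEntropy

namespace FiniteEntropy

/-! ### Invariance under push-forward, and evaluation on mixtures -/

section Transfer

variable {Ω Ω' ι 𝒲₁ 𝒲₂ 𝒜 ℬ 𝒞 𝒰 𝒱 χ₁ χ₂ θf θ₁ θ₂ η₁ η₂ : Type*} [Fintype Ω] [Fintype Ω']
  {q : Ω' → ℝ} {p : Ω → ℝ} {π : Ω' → Ω}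

theorem single₂₁_comp (hπ : ∀ f : Ω → ℝ, ∑ ω', q ω' * f (π ω') = ∑ ω, p ω * f ω) (x₁ : Ω → χ₁)
    (x₂ : Ω → χ₂) (a : Ω → θf) (b : Ω → θ₁) (c : Ω → θ₂) (y₁ : Ω → η₁) (y₂ : Ω → η₂) :
    single₂₁ q triv (x₁ ∘ π) (x₂ ∘ π) (a ∘ π) (b ∘ π) (c ∘ π) (y₁ ∘ π) (y₂ ∘ π) =
      single₂₁ p triv x₁ x₂ a b c y₁ y₂ := by
  simp only [single₂₁, ← ent_comp hπ]
  rfl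

theorem single₁₂_comp (hπ : ∀ f : Ω → ℝ, ∑ ω', q ω' * f (π ω') = ∑ ω, p ω * f ω) (x₁ : Ω → χ₁)
    (x₂ : Ω → χ₂) (a : Ω → θf) (b : Ω → θ₁) (c : Ω → θ₂) (y₁ : Ω → η₁) (y₂ : Ω → η₂) :
    single₁₂ q triv (x₁ ∘ π) (x₂ ∘ π) (a ∘ π) (b ∘ π) (c ∘ π) (y₁ ∘ π) (y₂ ∘ π) =
      single₁₂ p triv x₁ x₂ a b c y₁ y₂ := by
  simp only [single₁₂, ← ent_comp hπ]
  rfl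

theorem gain₂₁_comp (hπ : ∀ f : Ω → ℝ, ∑ ω', q ω' * f (π ω') = ∑ ω, p ω * f ω) (W₁ : Ω → 𝒲₁)
    (W₂ : Ω → 𝒲₂) (A : Ω → 𝒜) (B : Ω → ℬ) (C : Ω → 𝒞) (U : Ω → 𝒰) (V : Ω → 𝒱) :
    gain₂₁ q (W₁ ∘ π) (W₂ ∘ π) (A ∘ π) (B ∘ π) (C ∘ π) (U ∘ π) (V ∘ π) =
      gain₂₁ p W₁ W₂ A B C U V := by
  simp only [gain₂₁, ← ent_comp hπ]
  rfl

theorem gain₁₂_comp (hπ : ∀ f : Ω → ℝ, ∑ ω', q ω' * f (π ω') = ∑ ω, p ω * f ω) (W₁ : Ω → 𝒲₁)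
    (W₂ : Ω → 𝒲₂) (A : Ω → 𝒜) (B : Ω → ℬ) (C : Ω → 𝒞) (U : Ω → 𝒰) (V : Ω → 𝒱) :
    gain₁₂ q (W₁ ∘ π) (W₂ ∘ π) (A ∘ π) (B ∘ π) (C ∘ π) (U ∘ π) (V ∘ π) =
      gain₁₂ p W₁ W₂ A B C U V := by
  simp only [gain₁₂, ← ent_comp hπ]
  rfl

theorem CondIndep.comp (hπ : ∀ f : Ω → ℝ, ∑ ω', q ω' * f (π ω') = ∑ ω, p ω * f ω) {L : Ω → 𝒲₁}
    {R : Ω → 𝒲₂} {G : Ω → 𝒜} (h : CondIndep p L R G) : CondIndep q (L ∘ π) (R ∘ π) (G ∘ π) := by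
  simp only [CondIndep, ← ent_comp hπ] at h ⊢
  exact h

omit [Fintype Ω] [Fintype Ω'] in
theorem joint_comp (X : Ω → χ₁) (Y : Ω → χ₂) (π : Ω' → Ω) : (X ∘ π) ⋈ (Y ∘ π) = (X ⋈ Y) ∘ π :=
  rfl

variable [Fintype ι] [Nonempty ι] {r : ι → Ω → ℝ}

theorem ent_mixture_joint (hr : ∀ i ω, 0 ≤ r i ω) (hr1 : ∀ i, ∑ ω, r i ω = 1) (X : Ω → χ₁) :
    ent (fun w : ι × Ω => r w.1 w.2 / Fintype.card ι) (Prod.fst ⋈ (X ∘ Prod.snd)) =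
      Real.logb 2 (Fintype.card ι) + (∑ i, ent (r i) X) / Fintype.card ι :=
  ent_mixture hr hr1 X

theorem ent_mixture_fst (hr : ∀ i ω, 0 ≤ r i ω) (hr1 : ∀ i, ∑ ω, r i ω = 1) :
    ent (fun w : ι × Ω => r w.1 w.2 / Fintype.card ι) Prod.fst = Real.logb 2 (Fintype.card ι) := by
  have h := ent_mixture hr hr1 triv
  simp only [ent_triv (hr1 _), Finset.sum_const_zero, zero_div, add_zero] at h
  rw [← h]
  exact ent_congr fun ω ω' => by simp [triv]

/-- Conditioning on the mixing index averages entropies; the terms log |ι| cancel because entropies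
enter in differences. -/
theorem single₂₁_mixture (hr : ∀ i ω, 0 ≤ r i ω) (hr1 : ∀ i, ∑ ω, r i ω = 1)
    (x₁ : Ω → χ₁) (x₂ : Ω → χ₂) (a : Ω → θf) (b : Ω → θ₁) (c : Ω → θ₂) (y₁ : Ω → η₁)
    (y₂ : Ω → η₂) :
    single₂₁ (fun w : ι × Ω => r w.1 w.2 / Fintype.card ι) Prod.fst (x₁ ∘ Prod.snd)
      (x₂ ∘ Prod.snd) (a ∘ Prod.snd) (b ∘ Prod.snd) (c ∘ Prod.snd) (y₁ ∘ Prod.snd)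
      (y₂ ∘ Prod.snd) =
      (∑ i, single₂₁ (r i) triv x₁ x₂ a b c y₁ y₂) / Fintype.card ι := by
  simp only [single₂₁, joint_comp, ent_mixture_joint hr hr1, ent_mixture_fst hr hr1,
    ent_triv_joint, ent_triv (hr1 _), Finset.sum_add_distrib, Finset.sum_sub_distrib,
    Finset.sum_const_zero]
  ring

theorem single₁₂_mixture (hr : ∀ i ω, 0 ≤ r i ω) (hr1 : ∀ i, ∑ ω, r i ω = 1)
    (x₁ : Ω → χ₁) (x₂ : Ω → χ₂) (a : Ω → θf) (b : Ω → θ₁) (c : Ω → θ₂) (y₁ : Ω → η₁)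
    (y₂ : Ω → η₂) :
    single₁₂ (fun w : ι × Ω => r w.1 w.2 / Fintype.card ι) Prod.fst (x₁ ∘ Prod.snd)
      (x₂ ∘ Prod.snd) (a ∘ Prod.snd) (b ∘ Prod.snd) (c ∘ Prod.snd) (y₁ ∘ Prod.snd)
      (y₂ ∘ Prod.snd) =
      (∑ i, single₁₂ (r i) triv x₁ x₂ a b c y₁ y₂) / Fintype.card ι := by
  simp only [single₁₂, joint_comp, ent_mixture_joint hr hr1, ent_mixture_fst hr hr1,
    ent_triv_joint, ent_triv (hr1 _), Finset.sum_add_distrib, Finset.sum_sub_distrib,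
    Finset.sum_const_zero]
  ring

end Transfer

end FiniteEntropy

/-! ### The bounds as combinations of entropies of the channel law -/

namespace ISDModel

open FiniteEntropy

variable {X₁ X₂ YF Y₁ Y₂ Yf T₁ T₂ : Type*} [Fintype X₁] [Fintype X₂] [Fintype Y₁]
  [Fintype Y₂] [Fintype Yf] [Fintype T₁] [Fintype T₂]

omit [Fintype X₁] [Fintype X₂] [Fintype Y₁] [Fintype Y₂] in
theorem law_nonneg (S : ISDModel X₁ X₂ YF Y₁ Y₂ Yf T₁ T₂) {P : X₁ × X₂ → ℝ} (hP : ∀ x, 0 ≤ P x)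
    (v : X₁ × X₂ × Yf × T₁ × T₂) : 0 ≤ S.law P v :=
  mul_nonneg (mul_nonneg (hP _) ((S.noise₁_mem _).1 _)) ((S.noise₂_mem _).1 _)

omit [Fintype Y₁] [Fintype Y₂] in
theorem sum_law (S : ISDModel X₁ X₂ YF Y₁ Y₂ Yf T₁ T₂) {P : X₁ × X₂ → ℝ} (hP : ∑ x, P x = 1) :
    ∑ v, S.law P v = 1 := by
  have h : ∀ x₁, ∑ yf, ∑ t₁, S.noise₁ x₁ (yf, t₁) = 1 := fun x₁ => by
    rw [← Fintype.sum_prod_type']; exact (S.noise₁_mem x₁).2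
  simp only [Fintype.sum_prod_type, law, ← Finset.mul_sum, (S.noise₂_mem _).2, mul_one, h]
  rw [← Fintype.sum_prod_type']
  exact hP

theorem bound₂₁_eq_single (S : ISDModel X₁ X₂ YF Y₁ Y₂ Yf T₁ T₂) {P : X₁ × X₂ → ℝ}
    (hP : ∀ x, 0 ≤ P x) (hP1 : ∑ x, P x = 1) :
    S.bound₂₁ P = single₂₁ (S.law P) triv (fun v => v.1) (fun v => v.2.1) (fun v => v.2.2.1)
      (fun v => v.2.2.2.1) (fun v => v.2.2.2.2) (fun v => S.f₁ v.1 v.2.2.2.2)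
      (fun v => S.f₂ v.2.1 v.2.2.2.1) := by
  simp only [bound₂₁, single₂₁, condMutualInfo, condEntropy_eq_ent (S.law_nonneg hP),
    entropy_eq_ent, ent_triv_joint, ent_triv (S.sum_law hP1), sub_zero]
  rfl

theorem bound₁₂_eq_single (S : ISDModel X₁ X₂ YF Y₁ Y₂ Yf T₁ T₂) {P : X₁ × X₂ → ℝ}
    (hP : ∀ x, 0 ≤ P x) (hP1 : ∑ x, P x = 1) :
    S.bound₁₂ P = single₁₂ (S.law P) triv (fun v => v.1) (fun v => v.2.1) (fun v => v.2.2.1)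
      (fun v => v.2.2.2.1) (fun v => v.2.2.2.2) (fun v => S.f₁ v.1 v.2.2.2.2)
      (fun v => S.f₂ v.2.1 v.2.2.2.1) := by
  simp only [bound₁₂, single₁₂, condEntropy_eq_ent (S.law_nonneg hP),
    entropy_eq_ent, ent_triv_joint, ent_triv (S.sum_law hP1), sub_zero]
  rfl

/-! ### Averaging the input distributions -/

section TimeSharing

variable {ι : Type*} [Fintype ι] [Nonempty ι] (S : ISDModel X₁ X₂ YF Y₁ Y₂ Yf T₁ T₂)
  {P : ι → X₁ × X₂ → ℝ}

theorem average_mem (hP : ∀ i, P i ∈ stdSimplex ℝ (X₁ × X₂)) :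
    (fun x => (∑ i, P i x) / Fintype.card ι) ∈ stdSimplex ℝ (X₁ × X₂) := by
  refine ⟨fun x => div_nonneg (Finset.sum_nonneg fun i _ => (hP i).1 x) (Nat.cast_nonneg _), ?_⟩
  rw [← Finset.sum_div, Finset.sum_comm, Finset.sum_congr rfl fun i _ => (hP i).2]
  simp

omit [Fintype Y₁] [Fintype Y₂] [Nonempty ι] in
theorem sum_mixture_mul (f : X₁ × X₂ × Yf × T₁ × T₂ → ℝ) :
    ∑ w : ι × X₁ × X₂ × Yf × T₁ × T₂, S.law (P w.1) w.2 / Fintype.card ι * f w.2 =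
      ∑ v, S.law (fun x => (∑ i, P i x) / Fintype.card ι) v * f v := by
  rw [Fintype.sum_prod_type, Finset.sum_comm]
  refine Finset.sum_congr rfl fun v _ => ?_
  change ∑ i, S.law (P i) v / Fintype.card ι * f v = _
  rw [← Finset.sum_mul]
  congr 1
  simp only [law, Finset.sum_div, Finset.sum_mul]
  exact Finset.sum_congr rfl fun i _ => by ring

omit [Fintype Y₁] [Fintype Y₂] [Nonempty ι] in
-- The time index is treated as part of the past in `ent_kernelLaw`, since the noise kernels see
-- only the inputs. The variables enter through equations so that compositions with a projection
-- match them definitionally.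
theorem mixture_kernel (hP : ∀ i, P i ∈ stdSimplex ℝ (X₁ × X₂))
    (x₁ : ι × X₁ × X₂ × Yf × T₁ × T₂ → X₁) (x₂ : ι × X₁ × X₂ × Yf × T₁ × T₂ → X₂)
    (a : ι × X₁ × X₂ × Yf × T₁ × T₂ → Yf) (b : ι × X₁ × X₂ × Yf × T₁ × T₂ → T₁)
    (c : ι × X₁ × X₂ × Yf × T₁ × T₂ → T₂) (hx₁ : x₁ = fun w => w.2.1) (hx₂ : x₂ = fun w => w.2.2.1)
    (ha : a = fun w => w.2.2.2.1) (hb : b = fun w => w.2.2.2.2.1) (hc : c = fun w => w.2.2.2.2.2) :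
    let q := fun w : ι × X₁ × X₂ × Yf × T₁ × T₂ => S.law (P w.1) w.2 / Fintype.card ι
    (ent q ((a ⋈ b) ⋈ x₁) - ent q x₁) + (ent q (c ⋈ x₂) - ent q x₂)
      + ent q (Prod.fst ⋈ x₁ ⋈ x₂) ≤ ent q (Prod.fst ⋈ x₁ ⋈ x₂ ⋈ a ⋈ b ⋈ c) := by
  intro q
  subst hx₁ hx₂ ha hb hc
  let π : ι × X₁ × X₂ × Yf × T₁ × T₂ → (ι × X₁ × X₂) × (Yf × T₁) × T₂ := fun w =>
    ((w.1, w.2.1, w.2.2.1), (w.2.2.2.1, w.2.2.2.2.1), w.2.2.2.2.2)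
  have hπ : ∀ f : (ι × X₁ × X₂) × (Yf × T₁) × T₂ → ℝ, ∑ w, q w * f (π w) =
      ∑ w, kernelLaw (fun x : ι × X₁ × X₂ => P x.1 x.2 / Fintype.card ι) (fun x => x.2.1) S.noise₁
        (fun x => x.2.2) S.noise₂ w * f w := by
    intro f
    simp only [Fintype.sum_prod_type, q, π, kernelLaw, law]
    refine Finset.sum_congr rfl fun i _ => Finset.sum_congr rfl fun _ _ => Finset.sum_congr rfl
      fun _ _ => Finset.sum_congr rfl fun _ _ => Finset.sum_congr rfl fun _ _ => Finset.sum_congr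
      rfl fun _ _ => by ring
  have h := ent_kernelLaw (p := fun x : ι × X₁ × X₂ => P x.1 x.2 / Fintype.card ι)
    (x₁ := fun x => x.2.1) (x₂ := fun x => x.2.2) S.noise₁_mem S.noise₂_mem
    fun x => div_nonneg ((hP _).1 _) (Nat.cast_nonneg _)
  simp only [← ent_comp hπ] at h
  refine le_of_eq (Eq.trans h (ent_congr fun ω ω' => ?_))
  simp only [joint_eq_iff, π, Prod.mk.injEq, and_assoc]

/-- The average is the single-letter expression conditioned on a uniform index, and discarding that
index can only increase it. -/
theorem sum_bound₂₁_le (hP : ∀ i, P i ∈ stdSimplex ℝ (X₁ × X₂)) :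
    (∑ i, S.bound₂₁ (P i)) / Fintype.card ι ≤
      S.bound₂₁ fun x => (∑ i, P i x) / Fintype.card ι := by
  have hav := average_mem hP
  rw [S.bound₂₁_eq_single hav.1 hav.2, Finset.sum_congr rfl fun i _ =>
    S.bound₂₁_eq_single (hP i).1 (hP i).2, ← single₂₁_mixture
      (fun i => S.law_nonneg (hP i).1) (fun i => S.sum_law (hP i).2),
    ← single₂₁_comp (S.sum_mixture_mul (P := P))]
  refine single₂₁_cond_le (fun w => div_nonneg (S.law_nonneg (hP _).1 _) (Nat.cast_nonneg _))
    ?_ ?_ ?_ (S.mixture_kernel hP _ _ _ _ _ rfl rfl rfl rfl rfl)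
  · intro w w' h
    simp only [Function.comp] at h ⊢
    rw [h]; exact (S.f₁_inj _).eq_iff
  · intro w w' h
    simp only [Function.comp] at h ⊢
    rw [h]; exact (S.f₂_inj _).eq_iff
  · have h := S.sum_mixture_mul (P := P) fun _ => 1
    simpa only [mul_one, S.sum_law hav.2] using h

theorem sum_bound₁₂_le (hP : ∀ i, P i ∈ stdSimplex ℝ (X₁ × X₂)) :
    (∑ i, S.bound₁₂ (P i)) / Fintype.card ι ≤
      S.bound₁₂ fun x => (∑ i, P i x) / Fintype.card ι := by
  have hav := average_mem hP
  rw [S.bound₁₂_eq_single hav.1 hav.2, Finset.sum_congr rfl fun i _ =>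
    S.bound₁₂_eq_single (hP i).1 (hP i).2, ← single₁₂_mixture
      (fun i => S.law_nonneg (hP i).1) (fun i => S.sum_law (hP i).2),
    ← single₁₂_comp (S.sum_mixture_mul (P := P))]
  refine single₁₂_cond_le (fun w => div_nonneg (S.law_nonneg (hP _).1 _) (Nat.cast_nonneg _))
    ?_ ?_ ?_ (S.mixture_kernel hP _ _ _ _ _ rfl rfl rfl rfl rfl)
  · intro w w' h
    simp only [Function.comp] at h ⊢
    rw [h]; exact (S.f₁_inj _).eq_iff
  · intro w w' h
    simp only [Function.comp] at h ⊢
    rw [h]; exact (S.f₂_inj _).eq_iff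
  · have h := S.sum_mixture_mul (P := P) fun _ => 1
    simpa only [mul_one, S.sum_law hav.2] using h

end TimeSharing

/-! ### Continuity of the bounds in the input distribution -/

section Continuity

theorem continuous_ent {Ω α : Type*} [Fintype Ω] [Fintype α] (X : Ω → α) :
    Continuous fun p : Ω → ℝ => ent p X := by
  classical
  simp only [← entropy_eq_ent, entropy, Real.logb, ← Finset.sum_neg_distrib]
  refine continuous_finsetSum _ fun a _ => ?_
  have h1 : Continuous fun p : Ω → ℝ => pmfOf p X a := by
    unfold pmfOf
    refine continuous_finsetSum _ fun ω _ => ?_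
    split_ifs <;> fun_prop
  have h2 := (Real.continuous_negMulLog.comp h1).div_const (Real.log 2)
  refine h2.congr fun p => ?_
  simp only [Real.negMulLog, Function.comp]
  ring

variable (S : ISDModel X₁ X₂ YF Y₁ Y₂ Yf T₁ T₂)

omit [Fintype X₁] [Fintype X₂] [Fintype Y₁] [Fintype Y₂] in
theorem continuous_law : Continuous fun P : X₁ × X₂ → ℝ => S.law P := by
  refine continuous_pi fun v => ?_
  simp only [law]
  fun_prop

omit [Fintype Y₁] [Fintype Y₂] in
theorem continuous_ent_law {α : Type*} [Fintype α] (X : X₁ × X₂ × Yf × T₁ × T₂ → α) :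
    Continuous fun P : X₁ × X₂ → ℝ => ent (S.law P) X :=
  (continuous_ent X).comp S.continuous_law

/-- The conditional entropies in the bound contain quotients of probabilities. On the simplex the
bound is a linear combination of entropies, each continuous because x log x is continuous at 0. -/
theorem continuousOn_bound₂₁ : ContinuousOn S.bound₂₁ (stdSimplex ℝ (X₁ × X₂)) := by
  refine ContinuousOn.congr (Continuous.continuousOn ?_)
    fun P hP => S.bound₂₁_eq_single hP.1 hP.2
  unfold single₂₁
  repeat' first | exact S.continuous_ent_law _ | apply Continuous.sub | apply Continuous.add

theorem continuousOn_bound₁₂ : ContinuousOn S.bound₁₂ (stdSimplex ℝ (X₁ × X₂)) := by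
  refine ContinuousOn.congr (Continuous.continuousOn ?_)
    fun P hP => S.bound₁₂_eq_single hP.1 hP.2
  unfold single₁₂
  repeat' first | exact S.continuous_ent_law _ | apply Continuous.sub | apply Continuous.add

end Continuity

end ISDModel

namespace FiniteEntropy

/-- Base case of the time recursion: empty blocks carry no information, and independence of the
messages gives the conditional independence. -/
theorem gains_of_const {Ω 𝒲₁ 𝒲₂ 𝒜 ℬ 𝒞 𝒰 𝒱 : Type*} [Fintype Ω] {p : Ω → ℝ}
    (hp1 : ∑ ω, p ω = 1) {W₁ : Ω → 𝒲₁} {W₂ : Ω → 𝒲₂} {A : Ω → 𝒜} {B : Ω → ℬ} {C : Ω → 𝒞}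
    {U : Ω → 𝒰} {V : Ω → 𝒱}
    (hc : ∀ ω ω', A ω = A ω' ∧ B ω = B ω' ∧ C ω = C ω' ∧ U ω = U ω' ∧ V ω = V ω') :
    (ent p W₁ + ent p W₂ ≤ ent p (W₁ ⋈ W₂) → CondIndep p (W₁ ⋈ B) (W₂ ⋈ C) A) ∧
      gain₂₁ p W₁ W₂ A B C U V = 0 ∧ gain₁₂ p W₁ W₂ A B C U V = 0 := by
  have t := ent_triv hp1
  have cA : ∀ ω ω', A ω = A ω' := fun ω ω' => (hc ω ω').1
  have cB : ∀ ω ω', B ω = B ω' := fun ω ω' => (hc ω ω').2.1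
  have cC : ∀ ω ω', C ω = C ω' := fun ω ω' => (hc ω ω').2.2.1
  have cU : ∀ ω ω', U ω = U ω' := fun ω ω' => (hc ω ω').2.2.2.1
  have cV : ∀ ω ω', V ω = V ω' := fun ω ω' => (hc ω ω').2.2.2.2
  have e₁ : ent p A = ent p triv := ent_congr fun ω ω' => by simp [cA ω ω', triv]
  have e₂ : ent p U = ent p triv := ent_congr fun ω ω' => by simp [cU ω ω', triv]
  have e₃ : ent p V = ent p triv := ent_congr fun ω ω' => by simp [cV ω ω', triv]
  have e₄ : ent p ((W₁ ⋈ B) ⋈ A) = ent p W₁ :=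
    ent_congr fun ω ω' => by simp [joint_eq_iff, cA ω ω', cB ω ω']
  have e₅ : ent p ((W₂ ⋈ C) ⋈ A) = ent p W₂ :=
    ent_congr fun ω ω' => by simp [joint_eq_iff, cA ω ω', cC ω ω']
  have e₆ : ent p ((W₁ ⋈ B) ⋈ (W₂ ⋈ C) ⋈ A) = ent p (W₁ ⋈ W₂) :=
    ent_congr fun ω ω' => by simp [joint_eq_iff, cA ω ω', cB ω ω', cC ω ω']
  have e₇ : ent p (U ⋈ W₁) = ent p W₁ :=
    ent_congr fun ω ω' => by simp [joint_eq_iff, cU ω ω']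
  have e₈ : ent p (V ⋈ W₂) = ent p W₂ :=
    ent_congr fun ω ω' => by simp [joint_eq_iff, cV ω ω']
  have e₉ : ent p (U ⋈ B ⋈ A ⋈ W₂) = ent p W₂ :=
    ent_congr fun ω ω' => by simp [joint_eq_iff, cA ω ω', cB ω ω', cU ω ω']
  have f₁ : ent p (U ⋈ B ⋈ A ⋈ W₁ ⋈ W₂) = ent p (W₁ ⋈ W₂) :=
    ent_congr fun ω ω' => by simp [joint_eq_iff, cA ω ω', cB ω ω', cU ω ω']
  have f₂ : ent p (V ⋈ C ⋈ A) = ent p triv :=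
    ent_congr fun ω ω' => by simp [joint_eq_iff, cA ω ω', cC ω ω', cV ω ω', triv]
  have f₃ : ent p (V ⋈ C ⋈ A ⋈ W₁) = ent p W₁ :=
    ent_congr fun ω ω' => by simp [joint_eq_iff, cA ω ω', cC ω ω', cV ω ω']
  have f₄ : ent p (V ⋈ C ⋈ A ⋈ W₂) = ent p W₂ :=
    ent_congr fun ω ω' => by simp [joint_eq_iff, cA ω ω', cC ω ω', cV ω ω']
  have f₅ : ent p (V ⋈ C ⋈ A ⋈ W₁ ⋈ W₂) = ent p (W₁ ⋈ W₂) :=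
    ent_congr fun ω ω' => by simp [joint_eq_iff, cA ω ω', cC ω ω', cV ω ω']
  have f₆ : ent p (U ⋈ A ⋈ B) = ent p triv :=
    ent_congr fun ω ω' => by simp [joint_eq_iff, cA ω ω', cB ω ω', cU ω ω', triv]
  have f₇ : ent p (U ⋈ A ⋈ B ⋈ W₁) = ent p W₁ :=
    ent_congr fun ω ω' => by simp [joint_eq_iff, cA ω ω', cB ω ω', cU ω ω']
  refine ⟨fun h => ?_, ?_, ?_⟩
  · rw [CondIndep, e₁, e₄, e₅, e₆, t, add_zero]; exact h
  · rw [gain₂₁, e₂, e₇, e₉, f₁, f₂, f₄, t]; ring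
  · rw [gain₁₂, e₃, e₈, f₃, f₅, f₆, f₇, t]; ring

end FiniteEntropy

namespace ISDModel

open FiniteEntropy

/-! ### The process of messages and noises, and the induction on time -/

section Paths

/-- The two messages together with `k` uses of the noise variables. -/
abbrev Path (Yf T₁ T₂ : Type*) (M₁ M₂ k : ℕ) : Type _ :=
  (Fin M₁ × Fin M₂) × (Fin k → (Yf × T₁) × T₂)

/-- Splitting off the last channel use. -/
def splitLast (Yf T₁ T₂ : Type*) (M₁ M₂ k : ℕ) :
    Path Yf T₁ T₂ M₁ M₂ (k + 1) ≃ Path Yf T₁ T₂ M₁ M₂ k × (Yf × T₁) × T₂ where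
  toFun ω := ((ω.1, Fin.init ω.2), ω.2 (Fin.last k))
  invFun w := (w.1.1, Fin.snoc w.1.2 w.2)
  left_inv ω := by simp
  right_inv w := by simp

variable {X₁ X₂ YF Y₁ Y₂ Yf T₁ T₂ : Type*} [Fintype Yf] [Fintype T₁] [Fintype T₂]
  (S : ISDModel X₁ X₂ YF Y₁ Y₂ Yf T₁ T₂) {M₁ M₂ : ℕ} (g₁ : ℕ → Fin M₁ → X₁)
  (g₂ : (i : ℕ) → Fin M₂ → (Fin i → Yf) → X₂) (k : ℕ)

/-- The first message. -/
def msg₁ (ω : Path Yf T₁ T₂ M₁ M₂ k) : Fin M₁ := ω.1.1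

/-- The second message. -/
def msg₂ (ω : Path Yf T₁ T₂ M₁ M₂ k) : Fin M₂ := ω.1.2

/-- The block `Yf ^ k`. -/
def blockYf (ω : Path Yf T₁ T₂ M₁ M₂ k) : Fin k → Yf := fun i => (ω.2 i).1.1

/-- The block `T₁ ^ k`. -/
def blockT₁ (ω : Path Yf T₁ T₂ M₁ M₂ k) : Fin k → T₁ := fun i => (ω.2 i).1.2

/-- The block `T₂ ^ k`. -/
def blockT₂ (ω : Path Yf T₁ T₂ M₁ M₂ k) : Fin k → T₂ := fun i => (ω.2 i).2

/-- The block of inputs of the second transmitter. -/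
def blockX₂ (ω : Path Yf T₁ T₂ M₁ M₂ k) : Fin k → X₂ :=
  fun i => g₂ i ω.1.2 fun j => (ω.2 (Fin.castLE i.isLt.le j)).1.1

/-- The block of outputs at the first receiver. -/
def blockY₁ (ω : Path Yf T₁ T₂ M₁ M₂ k) : Fin k → Y₁ := fun i => S.f₁ (g₁ i ω.1.1) (ω.2 i).2

/-- The block of outputs at the second receiver. -/
def blockY₂ (ω : Path Yf T₁ T₂ M₁ M₂ k) : Fin k → Y₂ :=
  fun i => S.f₂ (blockX₂ g₂ k ω i) (ω.2 i).1.2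

/-- The joint law of the messages and of the noise variables of `k` channel uses, when the inputs
are `g₁ i W₁` and `g₂ i W₂ (Yf ^ (i - 1))`. -/
noncomputable def pathLaw (ω : Path Yf T₁ T₂ M₁ M₂ k) : ℝ :=
  1 / (M₁ : ℝ) * (1 / (M₂ : ℝ)) * ∏ i : Fin k, (S.noise₁ (g₁ i ω.1.1) (ω.2 i).1 *
    S.noise₂ (blockX₂ g₂ k ω i) (ω.2 i).2)

/-- The input of the first transmitter after `k` channel uses. -/
def nextX₁ (ω : Path Yf T₁ T₂ M₁ M₂ k) : X₁ := g₁ k ω.1.1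

/-- The input of the second transmitter after `k` channel uses. -/
def nextX₂ (ω : Path Yf T₁ T₂ M₁ M₂ k) : X₂ := g₂ k ω.1.2 (blockYf k ω)

theorem pathLaw_nonneg (ω : Path Yf T₁ T₂ M₁ M₂ k) : 0 ≤ S.pathLaw g₁ g₂ k ω :=
  mul_nonneg (by positivity) (Finset.prod_nonneg fun _ _ =>
    mul_nonneg ((S.noise₁_mem _).1 _) ((S.noise₂_mem _).1 _))

theorem pathLaw_succ (ω : Path Yf T₁ T₂ M₁ M₂ (k + 1)) :
    S.pathLaw g₁ g₂ (k + 1) ω = kernelLaw (S.pathLaw g₁ g₂ k) (nextX₁ g₁ k) S.noise₁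
      (nextX₂ g₂ k) S.noise₂ (splitLast Yf T₁ T₂ M₁ M₂ k ω) := by
  rw [pathLaw, Fin.prod_univ_castSucc, kernelLaw, pathLaw, ← mul_assoc, ← mul_assoc]
  rfl

theorem sum_pathLaw_succ (f : Path Yf T₁ T₂ M₁ M₂ k × (Yf × T₁) × T₂ → ℝ) :
    ∑ ω, S.pathLaw g₁ g₂ (k + 1) ω * f (splitLast Yf T₁ T₂ M₁ M₂ k ω) =
      ∑ w, kernelLaw (S.pathLaw g₁ g₂ k) (nextX₁ g₁ k) S.noise₁ (nextX₂ g₂ k) S.noise₂ w * f w := by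
  simp only [pathLaw_succ]
  exact (splitLast Yf T₁ T₂ M₁ M₂ k).sum_comp fun w =>
    kernelLaw (S.pathLaw g₁ g₂ k) (nextX₁ g₁ k) S.noise₁ (nextX₂ g₂ k) S.noise₂ w * f w

theorem sum_pathLaw_init (f : Path Yf T₁ T₂ M₁ M₂ k → ℝ) :
    ∑ ω, S.pathLaw g₁ g₂ (k + 1) ω * f (splitLast Yf T₁ T₂ M₁ M₂ k ω).1 =
      ∑ ω, S.pathLaw g₁ g₂ k ω * f ω := by
  rw [S.sum_pathLaw_succ g₁ g₂ k fun w => f w.1]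
  exact sum_kernelLaw_mul S.noise₁_mem S.noise₂_mem f

theorem sum_pathLaw_msg (f : Fin M₁ × Fin M₂ → ℝ) :
    ∑ ω, S.pathLaw g₁ g₂ k ω * f ω.1 = ∑ w, 1 / (M₁ : ℝ) * (1 / (M₂ : ℝ)) * f w := by
  induction k with
  | zero => simp [Fintype.sum_prod_type, pathLaw]
  | succ k ih => rw [← ih, ← S.sum_pathLaw_init g₁ g₂ k fun ω => f ω.1]; rfl

theorem sum_pathLaw (h₁ : 0 < M₁) (h₂ : 0 < M₂) :
    ∑ ω : Path Yf T₁ T₂ M₁ M₂ k, S.pathLaw g₁ g₂ k ω = 1 := by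
  have h := S.sum_pathLaw_msg g₁ g₂ k fun _ => 1
  have e₁ : (M₁ : ℝ) ≠ 0 := by exact_mod_cast h₁.ne'
  have e₂ : (M₂ : ℝ) ≠ 0 := by exact_mod_cast h₂.ne'
  simp only [mul_one] at h
  rw [h]
  simp
  field_simp

theorem ent_msg (h₁ : 0 < M₁) (h₂ : 0 < M₂) :
    ent (S.pathLaw g₁ g₂ k) (msg₁ k) = Real.logb 2 M₁ ∧
    ent (S.pathLaw g₁ g₂ k) (msg₂ k) = Real.logb 2 M₂ ∧
    ent (S.pathLaw g₁ g₂ k) (msg₁ k ⋈ msg₂ k) = Real.logb 2 M₁ + Real.logb 2 M₂ := by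
  obtain ⟨a₁, a₂, a₃⟩ := ent_uniform_prod h₁ h₂
  have hπ := S.sum_pathLaw_msg g₁ g₂ k
  exact ⟨(ent_comp hπ Prod.fst).trans a₁, (ent_comp hπ Prod.snd).trans a₂,
    (ent_comp hπ id).trans a₃⟩

omit [Fintype Yf] [Fintype T₁] [Fintype T₂] in
theorem path_eq_iff {k : ℕ} {ω ω' : Path Yf T₁ T₂ M₁ M₂ k} :
    ω = ω' ↔ msg₁ k ω = msg₁ k ω' ∧ msg₂ k ω = msg₂ k ω' ∧ blockYf k ω = blockYf k ω' ∧
      blockT₁ k ω = blockT₁ k ω' ∧ blockT₂ k ω = blockT₂ k ω' := by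
  refine ⟨fun h => by simp [h], fun ⟨h₁, h₂, hA, hB, hC⟩ => ?_⟩
  exact Prod.ext (Prod.ext h₁ h₂) (funext fun i =>
    Prod.ext (Prod.ext (congrFun hA i) (congrFun hB i)) (congrFun hC i))

theorem eq_iff_init_eq_and_last_eq {τ : Type*} {f g : Fin (k + 1) → τ} :
    f = g ↔ Fin.init f = Fin.init g ∧ f (Fin.last k) = g (Fin.last k) := by
  refine ⟨fun h => by simp [h], fun h => ?_⟩
  rw [← Fin.snoc_init_self f, ← Fin.snoc_init_self g, h.1, h.2]

variable [Fintype X₁] [Fintype X₂] [Fintype Y₁] [Fintype Y₂]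

/-- The law of the inputs of channel use `k`. -/
noncomputable def inputLaw : X₁ × X₂ → ℝ :=
  pmfOf (S.pathLaw g₁ g₂ k) (nextX₁ g₁ k ⋈ nextX₂ g₂ k)

omit [Fintype Y₁] [Fintype Y₂] in
theorem inputLaw_mem (h₁ : 0 < M₁) (h₂ : 0 < M₂) :
    S.inputLaw g₁ g₂ k ∈ stdSimplex ℝ (X₁ × X₂) := by
  refine ⟨fun x => Finset.sum_nonneg fun ω _ => ?_, ?_⟩
  · split_ifs
    · exact S.pathLaw_nonneg g₁ g₂ k ω
    · exact le_rfl
  · have h := sum_pmfOf_mul (S.pathLaw g₁ g₂ k) (nextX₁ g₁ k ⋈ nextX₂ g₂ k) fun _ => 1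
    simp only [mul_one, S.sum_pathLaw g₁ g₂ k h₁ h₂] at h
    exact h

/-- The variables of channel use `k`. -/
def letter (ω : Path Yf T₁ T₂ M₁ M₂ (k + 1)) : X₁ × X₂ × Yf × T₁ × T₂ :=
  (nextX₁ g₁ k (splitLast Yf T₁ T₂ M₁ M₂ k ω).1, nextX₂ g₂ k (splitLast Yf T₁ T₂ M₁ M₂ k ω).1,
    (ω.2 (Fin.last k)).1.1, (ω.2 (Fin.last k)).1.2, (ω.2 (Fin.last k)).2)

omit [Fintype Y₁] [Fintype Y₂] in
-- Memorylessness: given the current inputs, the current noises have the channel law whatever the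
-- past, so the letter has the single-letter law at `inputLaw`.
theorem sum_pathLaw_letter (f : X₁ × X₂ × Yf × T₁ × T₂ → ℝ) :
    ∑ ω, S.pathLaw g₁ g₂ (k + 1) ω * f (letter g₁ g₂ k ω) =
      ∑ v, S.law (S.inputLaw g₁ g₂ k) v * f v := by
  refine (S.sum_pathLaw_succ g₁ g₂ k fun w => f (nextX₁ g₁ k w.1, nextX₂ g₂ k w.1, w.2.1.1,
    w.2.1.2, w.2.2)).trans ?_
  have h := sum_pmfOf_mul (S.pathLaw g₁ g₂ k) (nextX₁ g₁ k ⋈ nextX₂ g₂ k) fun x =>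
    ∑ yf, ∑ t₁, ∑ t₂, S.noise₁ x.1 (yf, t₁) * S.noise₂ x.2 t₂ * f (x.1, x.2, yf, t₁, t₂)
  rw [Fintype.sum_prod_type] at h ⊢
  simp only [Fintype.sum_prod_type, kernelLaw, law, Finset.mul_sum, ← mul_assoc] at h ⊢
  exact h.symm

omit [Fintype X₁] [Fintype X₂] [Fintype Y₁] [Fintype Y₂] in
-- For `hV`, the message W₂ and the past of Yf determine the whole input block of transmitter 2,
-- after which injectivity of f₂ applies letter by letter. `kernel` is the equality of
-- `ent_kernelLaw` with the whole past as base space.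
theorem isStep (h₁ : 0 < M₁) (h₂ : 0 < M₂)
    (hCI : CondIndep (S.pathLaw g₁ g₂ k) (msg₁ k ⋈ blockT₁ k) (msg₂ k ⋈ blockT₂ k)
      (blockYf k)) :
    IsStep (S.pathLaw g₁ g₂ (k + 1)) (msg₁ (k + 1)) (msg₂ (k + 1))
      (blockYf k ∘ Prod.fst ∘ splitLast Yf T₁ T₂ M₁ M₂ k)
      (blockT₁ k ∘ Prod.fst ∘ splitLast Yf T₁ T₂ M₁ M₂ k)
      (blockT₂ k ∘ Prod.fst ∘ splitLast Yf T₁ T₂ M₁ M₂ k)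
      (S.blockY₁ g₁ k ∘ Prod.fst ∘ splitLast Yf T₁ T₂ M₁ M₂ k)
      (S.blockY₂ g₂ k ∘ Prod.fst ∘ splitLast Yf T₁ T₂ M₁ M₂ k)
      (fun ω => (letter g₁ g₂ k ω).1) (fun ω => (letter g₁ g₂ k ω).2.1)
      (fun ω => (letter g₁ g₂ k ω).2.2.1) (fun ω => (letter g₁ g₂ k ω).2.2.2.1)
      (fun ω => (letter g₁ g₂ k ω).2.2.2.2)
      (fun ω => S.f₁ (letter g₁ g₂ k ω).1 (letter g₁ g₂ k ω).2.2.2.2)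
      (fun ω => S.f₂ (letter g₁ g₂ k ω).2.1 (letter g₁ g₂ k ω).2.2.2.1)
      (blockYf (k + 1)) (blockT₁ (k + 1)) (blockT₂ (k + 1)) (S.blockY₁ g₁ (k + 1))
      (S.blockY₂ g₂ (k + 1)) where
  nonneg := S.pathLaw_nonneg g₁ g₂ (k + 1)
  sum_eq_one := S.sum_pathLaw g₁ g₂ (k + 1) h₁ h₂
  hx₁ ω ω' h := congrArg (g₁ k) h
  hx₂ ω ω' h h' := congrArg₂ (g₂ k) h h'
  hU ω ω' h := by
    have h : ω.1.1 = ω'.1.1 := h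
    simp only [Function.comp, blockY₁, blockT₂, funext_iff, splitLast, Equiv.coe_fn_mk, h,
      (S.f₁_inj _).eq_iff]
  hV ω ω' h h' := by
    have h : ω.1.2 = ω'.1.2 := h
    have hx : blockX₂ g₂ k (splitLast Yf T₁ T₂ M₁ M₂ k ω).1 =
        blockX₂ g₂ k (splitLast Yf T₁ T₂ M₁ M₂ k ω').1 := by
      funext i
      exact congrArg₂ (g₂ i) h (funext fun j => congrFun h' (Fin.castLE i.isLt.le j))
    simp only [Function.comp, blockY₂, blockT₁, funext_iff, hx, (S.f₂_inj _).eq_iff]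
  hy₁ ω ω' h := by rw [h]; exact (S.f₁_inj _).eq_iff
  hy₂ ω ω' h := by rw [h]; exact (S.f₂_inj _).eq_iff
  hA' ω ω' := eq_iff_init_eq_and_last_eq k
  hB' ω ω' := eq_iff_init_eq_and_last_eq k
  hC' ω ω' := eq_iff_init_eq_and_last_eq k
  hU' ω ω' := eq_iff_init_eq_and_last_eq k
  hV' ω ω' := eq_iff_init_eq_and_last_eq k
  kernel := by
    have h := ent_kernelLaw (p := S.pathLaw g₁ g₂ k) (x₁ := nextX₁ g₁ k) (x₂ := nextX₂ g₂ k)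
      S.noise₁_mem S.noise₂_mem (S.pathLaw_nonneg g₁ g₂ k)
    have hπ := S.sum_pathLaw_succ g₁ g₂ k
    rw [← ent_comp hπ fun w => (w.2.1, nextX₁ g₁ k w.1), ← ent_comp hπ fun w => nextX₁ g₁ k w.1,
      ← ent_comp hπ fun w => (w.2.2, nextX₂ g₂ k w.1), ← ent_comp hπ fun w => nextX₂ g₂ k w.1,
      ← ent_comp hπ fun w => w.1, ← ent_comp hπ fun w => w] at h
    have e₁ : ent (S.pathLaw g₁ g₂ (k + 1)) (fun ω => (splitLast Yf T₁ T₂ M₁ M₂ k ω).1) =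
        ent (S.pathLaw g₁ g₂ (k + 1)) (msg₁ (k + 1) ⋈ msg₂ (k + 1) ⋈
          (blockYf k ∘ Prod.fst ∘ splitLast Yf T₁ T₂ M₁ M₂ k) ⋈
          (blockT₁ k ∘ Prod.fst ∘ splitLast Yf T₁ T₂ M₁ M₂ k) ⋈
          (blockT₂ k ∘ Prod.fst ∘ splitLast Yf T₁ T₂ M₁ M₂ k)) :=
      ent_congr fun ω ω' => by simp only [joint_eq_iff]; exact path_eq_iff
    have e₂ : ent (S.pathLaw g₁ g₂ (k + 1)) (fun ω => splitLast Yf T₁ T₂ M₁ M₂ k ω) =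
        ent (S.pathLaw g₁ g₂ (k + 1)) (msg₁ (k + 1) ⋈ msg₂ (k + 1) ⋈
          (blockYf k ∘ Prod.fst ∘ splitLast Yf T₁ T₂ M₁ M₂ k) ⋈
          (blockT₁ k ∘ Prod.fst ∘ splitLast Yf T₁ T₂ M₁ M₂ k) ⋈
          (blockT₂ k ∘ Prod.fst ∘ splitLast Yf T₁ T₂ M₁ M₂ k) ⋈
          (fun ω => (letter g₁ g₂ k ω).2.2.1) ⋈ (fun ω => (letter g₁ g₂ k ω).2.2.2.1) ⋈
          (fun ω => (letter g₁ g₂ k ω).2.2.2.2)) := by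
      refine ent_congr fun ω ω' => ?_
      simp only [joint_eq_iff]
      rw [Prod.ext_iff, path_eq_iff, Prod.ext_iff (x := (splitLast Yf T₁ T₂ M₁ M₂ k ω).2),
        Prod.ext_iff (x := (splitLast Yf T₁ T₂ M₁ M₂ k ω).2.1)]
      simp only [and_assoc]
      rfl
    rw [e₁, e₂] at h
    exact h.le
  condIndep := hCI.comp (S.sum_pathLaw_init g₁ g₂ k)

/-- The conditional independence is carried through the induction because each step consumes it.
Forgetting the last letter pushes the law of k + 1 uses to that of k uses, so gains of the past
agree under both. -/
theorem gains_le (h₁ : 0 < M₁) (h₂ : 0 < M₂) :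
    CondIndep (S.pathLaw g₁ g₂ k) (msg₁ k ⋈ blockT₁ k) (msg₂ k ⋈ blockT₂ k) (blockYf k) ∧
    gain₂₁ (S.pathLaw g₁ g₂ k) (msg₁ k) (msg₂ k) (blockYf k) (blockT₁ k) (blockT₂ k)
      (S.blockY₁ g₁ k) (S.blockY₂ g₂ k) ≤ ∑ i : Fin k, S.bound₂₁ (S.inputLaw g₁ g₂ i) ∧
    gain₁₂ (S.pathLaw g₁ g₂ k) (msg₁ k) (msg₂ k) (blockYf k) (blockT₁ k) (blockT₂ k)
      (S.blockY₁ g₁ k) (S.blockY₂ g₂ k) ≤ ∑ i : Fin k, S.bound₁₂ (S.inputLaw g₁ g₂ i) := by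
  induction k with
  | zero =>
    obtain ⟨a₁, a₂, a₃⟩ := S.ent_msg g₁ g₂ 0 h₁ h₂
    have hc : ∀ ω ω' : Path Yf T₁ T₂ M₁ M₂ 0, blockYf 0 ω = blockYf 0 ω' ∧
        blockT₁ 0 ω = blockT₁ 0 ω' ∧ blockT₂ 0 ω = blockT₂ 0 ω' ∧
        S.blockY₁ g₁ 0 ω = S.blockY₁ g₁ 0 ω' ∧ S.blockY₂ g₂ 0 ω = S.blockY₂ g₂ 0 ω' :=
      fun ω ω' => ⟨Subsingleton.elim _ _, Subsingleton.elim _ _, Subsingleton.elim _ _,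
        Subsingleton.elim _ _, Subsingleton.elim _ _⟩
    obtain ⟨b₁, b₂, b₃⟩ := gains_of_const (S.sum_pathLaw g₁ g₂ 0 h₁ h₂) hc (W₁ := msg₁ 0)
      (W₂ := msg₂ 0)
    refine ⟨b₁ (by rw [a₁, a₂, a₃]), by simp [b₂], by simp [b₃]⟩
  | succ k ih =>
    obtain ⟨ihC, ih₁, ih₂⟩ := ih
    have hs := S.isStep g₁ g₂ k h₁ h₂ ihC
    have hm := S.inputLaw_mem g₁ g₂ k h₁ h₂
    refine ⟨hs.condIndep_next, hs.gain₂₁_le.trans ?_, hs.gain₁₂_le.trans ?_⟩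
    · rw [Fin.sum_univ_castSucc]
      refine add_le_add ?_ (le_of_eq ?_)
      · exact (gain₂₁_comp (S.sum_pathLaw_init g₁ g₂ k) (msg₁ k) (msg₂ k) (blockYf k) (blockT₁ k)
          (blockT₂ k) (S.blockY₁ g₁ k) (S.blockY₂ g₂ k)).trans_le ih₁
      · refine Eq.trans ?_ (S.bound₂₁_eq_single hm.1 hm.2).symm
        exact single₂₁_comp (S.sum_pathLaw_letter g₁ g₂ k) (fun v => v.1) (fun v => v.2.1)
          (fun v => v.2.2.1) (fun v => v.2.2.2.1) (fun v => v.2.2.2.2)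
          (fun v => S.f₁ v.1 v.2.2.2.2) (fun v => S.f₂ v.2.1 v.2.2.2.1)
    · rw [Fin.sum_univ_castSucc]
      refine add_le_add ?_ (le_of_eq ?_)
      · exact (gain₁₂_comp (S.sum_pathLaw_init g₁ g₂ k) (msg₁ k) (msg₂ k) (blockYf k) (blockT₁ k)
          (blockT₂ k) (S.blockY₁ g₁ k) (S.blockY₂ g₂ k)).trans_le ih₂
      · refine Eq.trans ?_ (S.bound₁₂_eq_single hm.1 hm.2).symm
        exact single₁₂_comp (S.sum_pathLaw_letter g₁ g₂ k) (fun v => v.1) (fun v => v.2.1)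
          (fun v => v.2.2.1) (fun v => v.2.2.2.1) (fun v => v.2.2.2.2)
          (fun v => S.f₁ v.1 v.2.2.2.2) (fun v => S.f₂ v.2.1 v.2.2.2.1)

end Paths

end ISDModel

namespace ISDModel

open FiniteEntropy

/-! ### From decoding errors to a bound at one input distribution -/

section Fano

variable {X₁ X₂ YF Y₁ Y₂ Yf T₁ T₂ : Type*} [Fintype Yf] [Fintype T₁] [Fintype T₂]
  [Fintype X₁] [Fintype X₂] [Fintype Y₁] [Fintype Y₂]
  (S : ISDModel X₁ X₂ YF Y₁ Y₂ Yf T₁ T₂) {M₁ M₂ : ℕ} (g₁ : ℕ → Fin M₁ → X₁)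
  (g₂ : (i : ℕ) → Fin M₂ → (Fin i → Yf) → X₂) (k : ℕ)

/-- The error probability at the first receiver. -/
noncomputable def pathErr₁ (dec : (Fin k → Y₁) → Fin M₁) : ℝ :=
  ∑ ω : Path Yf T₁ T₂ M₁ M₂ k,
    if dec (S.blockY₁ g₁ k ω) ≠ msg₁ k ω then S.pathLaw g₁ g₂ k ω else 0

/-- The error probability at the second receiver. -/
noncomputable def pathErr₂ (dec : (Fin k → Y₂) → Fin M₂) : ℝ :=
  ∑ ω : Path Yf T₁ T₂ M₁ M₂ k,
    if dec (S.blockY₂ g₂ k ω) ≠ msg₂ k ω then S.pathLaw g₁ g₂ k ω else 0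

omit [Fintype X₁] [Fintype X₂] [Fintype Y₁] [Fintype Y₂] in
-- Each of the three informations is at least H(W) − H(W|Y) for its receiver's own output: the
-- genie's signals only help, and conditioning on the other message costs nothing by independence.
theorem le_gains (h₁ : 0 < M₁) (h₂ : 0 < M₂) (dec₁ : (Fin k → Y₁) → Fin M₁)
    (dec₂ : (Fin k → Y₂) → Fin M₂) :
    2 * (Real.logb 2 M₁ - (1 + S.pathErr₁ g₁ g₂ k dec₁ * Real.logb 2 M₁)) +
        (Real.logb 2 M₂ - (1 + S.pathErr₂ g₁ g₂ k dec₂ * Real.logb 2 M₂)) ≤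
      gain₂₁ (S.pathLaw g₁ g₂ k) (msg₁ k) (msg₂ k) (blockYf k) (blockT₁ k) (blockT₂ k)
        (S.blockY₁ g₁ k) (S.blockY₂ g₂ k) ∧
    (Real.logb 2 M₁ - (1 + S.pathErr₁ g₁ g₂ k dec₁ * Real.logb 2 M₁)) +
        2 * (Real.logb 2 M₂ - (1 + S.pathErr₂ g₁ g₂ k dec₂ * Real.logb 2 M₂)) ≤
      gain₁₂ (S.pathLaw g₁ g₂ k) (msg₁ k) (msg₂ k) (blockYf k) (blockT₁ k) (blockT₂ k)
        (S.blockY₁ g₁ k) (S.blockY₂ g₂ k) := by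
  obtain ⟨a₁, a₂, a₃⟩ := S.ent_msg g₁ g₂ k h₁ h₂
  have hp := S.pathLaw_nonneg g₁ g₂ k
  have hp1 := S.sum_pathLaw g₁ g₂ k h₁ h₂
  have F₁ := fano hp hp1 (msg₁ k) (S.blockY₁ g₁ k) dec₁
  have F₂ := fano hp hp1 (msg₂ k) (S.blockY₂ g₂ k) dec₂
  change _ ≤ 1 + S.pathErr₁ g₁ g₂ k dec₁ * Real.logb 2 M₁ at F₁
  change _ ≤ 1 + S.pathErr₂ g₁ g₂ k dec₂ * Real.logb 2 M₂ at F₂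
  generalize S.pathErr₁ g₁ g₂ k dec₁ = err₁ at *
  generalize S.pathErr₂ g₁ g₂ k dec₂ = err₂ at *
  generalize S.pathLaw g₁ g₂ k = p at *
  generalize S.blockY₁ g₁ k = U at *
  generalize S.blockY₂ g₂ k = V at *
  generalize blockYf (M₁ := M₁) (M₂ := M₂) (T₁ := T₁) (T₂ := T₂) (Yf := Yf) k = A at *
  generalize blockT₁ (M₁ := M₁) (M₂ := M₂) (T₁ := T₁) (T₂ := T₂) (Yf := Yf) k = B at *
  generalize blockT₂ (M₁ := M₁) (M₂ := M₂) (T₁ := T₁) (T₂ := T₂) (Yf := Yf) k = C at *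
  generalize msg₁ (M₁ := M₁) (M₂ := M₂) (T₁ := T₁) (T₂ := T₂) (Yf := Yf) k = W₁ at *
  generalize msg₂ (M₁ := M₁) (M₂ := M₂) (T₁ := T₁) (T₂ := T₂) (Yf := Yf) k = W₂ at *
  have e₁ : ent p (U ⋈ W₁) = ent p (W₁ ⋈ U) :=
    ent_congr fun ω ω' => by simp only [joint_eq_iff, and_comm]
  have e₂ : ent p (V ⋈ W₂) = ent p (W₂ ⋈ V) :=
    ent_congr fun ω ω' => by simp only [joint_eq_iff, and_comm]
  have key :
      (ent p (U ⋈ B ⋈ A ⋈ W₁ ⋈ W₂) + ent p U ≤ ent p (U ⋈ B ⋈ A ⋈ W₂) + ent p (W₁ ⋈ U)) ∧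
      (ent p (V ⋈ C ⋈ A ⋈ W₂) + ent p V ≤ ent p (V ⋈ C ⋈ A) + ent p (W₂ ⋈ V)) ∧
      (ent p (V ⋈ C ⋈ A ⋈ W₁ ⋈ W₂) + ent p V ≤ ent p (V ⋈ C ⋈ A ⋈ W₁) + ent p (W₂ ⋈ V)) ∧
      (ent p (U ⋈ A ⋈ B ⋈ W₁) + ent p U ≤ ent p (U ⋈ A ⋈ B) + ent p (W₁ ⋈ U)) := by
    refine ⟨ent_submod hp _ _ _ _ ?_ ?_ ?_, ent_submod hp _ _ _ _ ?_ ?_ ?_,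
      ent_submod hp _ _ _ _ ?_ ?_ ?_, ent_submod hp _ _ _ _ ?_ ?_ ?_⟩ <;> intro ω ω' <;>
      simp only [joint_eq_iff] <;> tauto
  obtain ⟨k₁, k₂, k₃, k₄⟩ := key
  unfold gain₂₁ gain₁₂
  constructor <;> linarith

/-- The converse for a fixed block length, at a single input distribution. -/
theorem exists_inputLaw (h₁ : 0 < M₁) (h₂ : 0 < M₂) (hk : 0 < k)
    (dec₁ : (Fin k → Y₁) → Fin M₁) (dec₂ : (Fin k → Y₂) → Fin M₂) :
    ∃ P ∈ stdSimplex ℝ (X₁ × X₂),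
      2 * (Real.logb 2 M₁ - (1 + S.pathErr₁ g₁ g₂ k dec₁ * Real.logb 2 M₁)) +
        (Real.logb 2 M₂ - (1 + S.pathErr₂ g₁ g₂ k dec₂ * Real.logb 2 M₂)) ≤ k * S.bound₂₁ P ∧
      (Real.logb 2 M₁ - (1 + S.pathErr₁ g₁ g₂ k dec₁ * Real.logb 2 M₁)) +
        2 * (Real.logb 2 M₂ - (1 + S.pathErr₂ g₁ g₂ k dec₂ * Real.logb 2 M₂)) ≤
        k * S.bound₁₂ P := by
  have : Nonempty (Fin k) := ⟨⟨0, hk⟩⟩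
  have hk' : (0 : ℝ) < k := by exact_mod_cast hk
  have hm : ∀ i : Fin k, S.inputLaw g₁ g₂ i ∈ stdSimplex ℝ (X₁ × X₂) :=
    fun i => S.inputLaw_mem g₁ g₂ i h₁ h₂
  have s₁ := S.sum_bound₂₁_le hm
  have s₂ := S.sum_bound₁₂_le hm
  rw [Fintype.card_fin, div_le_iff₀' hk'] at s₁ s₂
  obtain ⟨-, u₁, u₂⟩ := S.gains_le g₁ g₂ k h₁ h₂
  obtain ⟨l₁, l₂⟩ := S.le_gains g₁ g₂ k h₁ h₂ dec₁ dec₂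
  refine ⟨_, average_mem hm, ?_, ?_⟩
  · rw [Fintype.card_fin]; exact (l₁.trans u₁).trans s₁
  · rw [Fintype.card_fin]; exact (l₂.trans u₂).trans s₂

end Fano

/-! ### Rewriting the feedback in terms of Yf -/

section Feedback

variable {X₁ X₂ YF Y₁ Y₂ Yf T₁ T₂ : Type*} [Fintype Yf] [Fintype T₁] [Fintype T₂]
  (S : ISDModel X₁ X₂ YF Y₁ Y₂ Yf T₁ T₂)

/-- The feedback block, as a function of the block `Yf ^ k`. -/
def feedback (e : (i : ℕ) → (Fin i → YF) → X₂) : (k : ℕ) → (Fin k → Yf) → Fin k → YF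
  | 0, _ => Fin.elim0
  | k + 1, a => Fin.snoc (feedback e k (Fin.init a))
      (S.f₃ (e k (feedback e k (Fin.init a))) (a (Fin.last k)))

variable (e : (i : ℕ) → (Fin i → YF) → X₂)

/-- Causality: a prefix of the feedback depends only on the same prefix of Yf. -/
theorem feedback_castLE {i k : ℕ} (h : i ≤ k) (a : Fin k → Yf) :
    (fun j => S.feedback e k a (Fin.castLE h j)) = S.feedback e i fun j => a (Fin.castLE h j) := by
  induction k with
  | zero => obtain rfl := Nat.le_zero.mp h; rfl
  | succ k ih =>
    rcases Nat.le_succ_iff.mp h with h' | rfl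
    · refine Eq.trans (funext fun j => ?_) (ih h' (Fin.init a))
      exact Fin.snoc_castSucc (α := fun _ => YF) _ _ (Fin.castLE h' j)
    · rfl

theorem feedback_apply {k : ℕ} (a : Fin k → Yf) (i : Fin k) :
    S.feedback e k a i =
      S.f₃ (e i (S.feedback e i fun j => a (Fin.castLE i.isLt.le j))) (a i) := by
  have h := congrFun (S.feedback_castLE e (Nat.succ_le_of_lt i.isLt) a) (Fin.last i)
  refine Eq.trans h ?_
  rw [feedback, Fin.snoc_last]
  rfl

/-- Each symbol is determined by strictly earlier ones and by the current Yf, so strong induction on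
time gives uniqueness. -/
theorem eq_feedback {k : ℕ} (a : Fin k → Yf) (y : Fin k → YF)
    (h : ∀ i : Fin k, y i = S.f₃ (e i fun j => y (Fin.castLE i.isLt.le j)) (a i)) :
    y = S.feedback e k a := by
  have key : ∀ n (hn : n < k), y ⟨n, hn⟩ = S.feedback e k a ⟨n, hn⟩ := by
    intro n
    induction n using Nat.strong_induction_on with
    | _ n ih =>
      intro hn
      rw [h, feedback_apply, ← S.feedback_castLE e hn.le a]
      have : (fun j : Fin n => y (Fin.castLE hn.le j)) =
          fun j : Fin n => S.feedback e k a (Fin.castLE hn.le j) :=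
        funext fun j => ih j j.isLt _
      exact congrArg (fun x => S.f₃ (e n x) (a ⟨n, hn⟩)) this
  exact funext fun i => key i i.isLt

end Feedback

/-! ### The law and error probabilities of a code as those of a path -/

section Code

variable {X₁ X₂ YF Y₁ Y₂ Yf T₁ T₂ : Type*} [Fintype YF] [Fintype Y₁] [Fintype Y₂] [Fintype Yf]
  [Fintype T₁] [Fintype T₂] (C : MemorylessIC X₁ X₂ YF Y₁ Y₂)
  (S : ISDModel X₁ X₂ YF Y₁ Y₂ Yf T₁ T₂) {N M₁ M₂ : ℕ} (c : ICCode X₁ X₂ YF Y₁ Y₂ N M₁ M₂)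
  [Inhabited X₁] [Inhabited X₂]

/-- The first encoder, extended to all times. -/
def encExt₁ (i : ℕ) (w : Fin M₁) : X₁ := if h : i < N then c.enc₁ w ⟨i, h⟩ else default

/-- The second encoder, extended to all times. -/
def encExt₂ (w : Fin M₂) (i : ℕ) (y : Fin i → YF) : X₂ :=
  if h : i < N then c.enc₂ w ⟨i, h⟩ y else default

/-- The second encoder as a function of the past of `Yf`. -/
def encYf (i : ℕ) (w : Fin M₂) (a : Fin i → Yf) : X₂ :=
  encExt₂ c w i (S.feedback (encExt₂ c w) i a)

omit [Fintype YF] [Fintype Y₁] [Fintype Y₂] [Inhabited X₁] in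
theorem blockX₂_encYf (ω : Path Yf T₁ T₂ M₁ M₂ N) (i : Fin N) :
    blockX₂ (S.encYf c) N ω i = c.enc₂ ω.1.2 i fun j =>
      S.feedback (encExt₂ c ω.1.2) N (blockYf N ω) (Fin.castLE i.isLt.le j) := by
  rw [S.feedback_castLE]
  simp only [blockX₂, encYf, encExt₂, i.isLt, dif_pos, Fin.eta]
  rfl

open Classical in
-- Expanding the product over time of sums over noise letters gives a sum over noise sequences. The
-- indicators force the outputs to be the ones computed from the messages and the noise.
theorem codeLaw_eq (hS : S.Represents C) (w : Fin M₁ × Fin M₂) (yF : Fin N → YF)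
    (y₁ : Fin N → Y₁) (y₂ : Fin N → Y₂) :
    C.codeLaw c w.1 w.2 yF y₁ y₂ = ∑ z : Fin N → (Yf × T₁) × T₂,
      if yF = S.feedback (encExt₂ c w.2) N (blockYf N (w, z)) then
        if y₁ = S.blockY₁ (encExt₁ c) N (w, z) then
          if y₂ = S.blockY₂ (S.encYf c) N (w, z) then
            S.pathLaw (encExt₁ c) (S.encYf c) N (w, z) else 0 else 0 else 0 := by
  have hfac : ∀ i : Fin N, C.trans (c.enc₁ w.1 i)
      (c.enc₂ w.2 i fun j => yF (Fin.castLE i.isLt.le j)) (yF i, y₁ i, y₂ i) =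
      ∑ z : (Yf × T₁) × T₂, S.noise₁ (c.enc₁ w.1 i) z.1 *
        S.noise₂ (c.enc₂ w.2 i fun j => yF (Fin.castLE i.isLt.le j)) z.2 *
        (if y₁ i = S.f₁ (c.enc₁ w.1 i) z.2 then 1 else 0) *
        (if y₂ i = S.f₂ (c.enc₂ w.2 i fun j => yF (Fin.castLE i.isLt.le j)) z.1.2 then 1 else 0) *
        (if yF i = S.f₃ (c.enc₂ w.2 i fun j => yF (Fin.castLE i.isLt.le j)) z.1.1
          then 1 else 0) := by
    intro i
    rw [hS]
    simp only [Fintype.sum_prod_type]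
  have e₁ : ∀ i : Fin N, encExt₁ c i w.1 = c.enc₁ w.1 i := fun i => by
    simp [encExt₁, i.isLt]
  rw [MemorylessIC.codeLaw, Finset.prod_congr rfl fun i _ => hfac i, Finset.prod_univ_sum,
    Fintype.piFinset_univ, Finset.mul_sum]
  refine Finset.sum_congr rfl fun z _ => ?_
  by_cases hF : yF = S.feedback (encExt₂ c w.2) N (blockYf N (w, z))
  · have hx : ∀ i : Fin N, (c.enc₂ w.2 i fun j => yF (Fin.castLE i.isLt.le j)) =
        blockX₂ (S.encYf c) N (w, z) i := fun i => by rw [blockX₂_encYf, hF]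
    have hF' : ∀ i : Fin N, yF i = S.f₃ (blockX₂ (S.encYf c) N (w, z) i) (z i).1.1 := fun i => by
      rw [← hx, hF, feedback_apply, ← S.feedback_castLE (encExt₂ c w.2) i.isLt.le]
      simp only [encExt₂, i.isLt, dif_pos, Fin.eta]
      rfl
    simp only [hx, Finset.prod_mul_distrib, Finset.prod_ite_zero, Finset.prod_const_one,
      Finset.mem_univ, forall_const, if_pos hF]
    rw [if_pos hF']
    have c₁ : (∀ i, y₁ i = S.f₁ (c.enc₁ w.1 i) (z i).2) ↔
        y₁ = S.blockY₁ (encExt₁ c) N (w, z) := by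
      simp only [funext_iff, blockY₁, e₁]
    have c₂ : (∀ i, y₂ i = S.f₂ (blockX₂ (S.encYf c) N (w, z) i) (z i).1.2) ↔
        y₂ = S.blockY₂ (S.encYf c) N (w, z) := by
      simp only [funext_iff, blockY₂]
    simp only [c₁, c₂, pathLaw, e₁, Finset.prod_mul_distrib]
    split_ifs <;> ring
  · rw [if_neg hF]
    -- A nonzero product would make every f₃ indicator equal 1, so `yF` would solve the feedback
    -- recursion.
    by_contra hne
    refine hF (S.eq_feedback _ _ _ fun i => ?_)
    have := Finset.prod_ne_zero_iff.mp (right_ne_zero_of_mul hne) i (Finset.mem_univ i)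
    have h3 := right_ne_zero_of_mul this
    simp only [ne_eq, ite_eq_right_iff, one_ne_zero, imp_false, not_not] at h3
    rw [h3]
    simp only [encExt₂, i.isLt, dif_pos, Fin.eta]
    rfl

theorem sum_codeLaw (hS : S.Represents C) (w : Fin M₁ × Fin M₂)
    (φ : (Fin N → Y₁) → (Fin N → Y₂) → ℝ) :
    ∑ yF, ∑ y₁, ∑ y₂, C.codeLaw c w.1 w.2 yF y₁ y₂ * φ y₁ y₂ =
      ∑ z : Fin N → (Yf × T₁) × T₂, S.pathLaw (encExt₁ c) (S.encYf c) N (w, z) *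
        φ (S.blockY₁ (encExt₁ c) N (w, z)) (S.blockY₂ (S.encYf c) N (w, z)) := by
  classical
  simp only [S.codeLaw_eq C c hS, Finset.sum_mul]
  calc _ = ∑ z : Fin N → (Yf × T₁) × T₂, ∑ yF, ∑ y₁, ∑ y₂,
      (if yF = S.feedback (encExt₂ c w.2) N (blockYf N (w, z)) then
        if y₁ = S.blockY₁ (encExt₁ c) N (w, z) then
          if y₂ = S.blockY₂ (S.encYf c) N (w, z) then
            S.pathLaw (encExt₁ c) (S.encYf c) N (w, z) else 0 else 0 else 0) * φ y₁ y₂ := by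
        symm
        rw [Finset.sum_comm]
        refine Finset.sum_congr rfl fun yF _ => ?_
        rw [Finset.sum_comm]
        refine Finset.sum_congr rfl fun y₁ _ => ?_
        rw [Finset.sum_comm]
    _ = _ := by
        refine Finset.sum_congr rfl fun z _ => ?_
        rw [Finset.sum_eq_single (S.feedback (encExt₂ c w.2) N (blockYf N (w, z))),
          Finset.sum_eq_single (S.blockY₁ (encExt₁ c) N (w, z)),
          Finset.sum_eq_single (S.blockY₂ (S.encYf c) N (w, z))] <;> simp +contextual

theorem err₁_eq (hS : S.Represents C) :
    C.err₁ c = S.pathErr₁ (encExt₁ c) (S.encYf c) N c.dec₁ := by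
  rw [MemorylessIC.err₁, pathErr₁, Fintype.sum_prod_type, Fintype.sum_prod_type]
  refine Finset.sum_congr rfl fun w₁ _ => Finset.sum_congr rfl fun w₂ _ => ?_
  have h := S.sum_codeLaw C c hS (w₁, w₂) fun y₁ _ => if c.dec₁ y₁ ≠ w₁ then 1 else 0
  simp only [mul_ite, mul_one, mul_zero] at h
  exact h

theorem err₂_eq (hS : S.Represents C) :
    C.err₂ c = S.pathErr₂ (encExt₁ c) (S.encYf c) N c.dec₂ := by
  rw [MemorylessIC.err₂, pathErr₂, Fintype.sum_prod_type, Fintype.sum_prod_type]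
  refine Finset.sum_congr rfl fun w₁ _ => Finset.sum_congr rfl fun w₂ _ => ?_
  have h := S.sum_codeLaw C c hS (w₁, w₂) fun _ y₂ => if c.dec₂ y₂ ≠ w₂ then 1 else 0
  simp only [mul_ite, mul_one, mul_zero] at h
  exact h

end Code

/-! ### Asymptotics and passage to the closure -/

section Converse

variable {X₁ X₂ YF Y₁ Y₂ Yf T₁ T₂ : Type*} [Fintype X₁] [Fintype X₂] [Fintype YF]
  [Fintype Y₁] [Fintype Y₂] [Fintype Yf] [Fintype T₁] [Fintype T₂]
  {C : MemorylessIC X₁ X₂ YF Y₁ Y₂} {S : ISDModel X₁ X₂ YF Y₁ Y₂ Yf T₁ T₂}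

theorem logb_floor_bounds {x : ℝ} (hx : 0 ≤ x) :
    0 < ⌊(2 : ℝ) ^ x⌋₊ ∧ x - 1 ≤ Real.logb 2 ⌊(2 : ℝ) ^ x⌋₊ ∧
      Real.logb 2 ⌊(2 : ℝ) ^ x⌋₊ ≤ x ∧ 0 ≤ Real.logb 2 ⌊(2 : ℝ) ^ x⌋₊ := by
  have h1 : (1 : ℝ) ≤ 2 ^ x := Real.one_le_rpow (by norm_num) hx
  have hpos : 0 < ⌊(2 : ℝ) ^ x⌋₊ := Nat.floor_pos.mpr h1
  have hge : (1 : ℝ) ≤ ⌊(2 : ℝ) ^ x⌋₊ := by exact_mod_cast hpos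
  have hle : (⌊(2 : ℝ) ^ x⌋₊ : ℝ) ≤ 2 ^ x := Nat.floor_le (by linarith)
  have hlt := Nat.lt_floor_add_one ((2 : ℝ) ^ x)
  refine ⟨hpos, ?_, ?_, Real.logb_nonneg (by norm_num) hge⟩
  · rw [Real.le_logb_iff_rpow_le (by norm_num) (by linarith), Real.rpow_sub_one (by norm_num)]
    linarith
  · exact (Real.logb_le_iff_le_rpow (by norm_num) (by linarith)).mpr hle

theorem exists_of_achievable (hS : S.Represents C) {R : ℝ × ℝ} (h₁ : 0 ≤ R.1) (h₂ : 0 ≤ R.2)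
    (hR : ∀ ε : ℝ, 0 < ε → C.EpsAchievable ε R) {δ : ℝ} (hδ : 0 < δ) :
    ∃ P ∈ stdSimplex ℝ (X₁ × X₂),
      2 * R.1 + R.2 - δ ≤ S.bound₂₁ P ∧ R.1 + 2 * R.2 - δ ≤ S.bound₁₂ P := by
  -- With weights adding up to 3, flooring the message counts and the constant in Fano cost at most
  -- 3 bits each, so N ≥ 12/δ puts these 6 bits below Nδ/2. The choice of ε keeps the error terms
  -- below Nδ/2; the summand 1 keeps the denominator positive at zero rates.
  set ε := δ / (2 * (2 * R.1 + 2 * R.2 + 1)) with hε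
  have hden : 0 < 2 * (2 * R.1 + 2 * R.2 + 1) := by linarith
  have hεpos : 0 < ε := div_pos hδ hden
  have hεmul : ε * (2 * (2 * R.1 + 2 * R.2 + 1)) = δ := div_mul_cancel₀ _ hden.ne'
  obtain ⟨N, ⟨c, hc⟩, hN12, hN⟩ := ((hR ε hεpos).and
    (((tendsto_natCast_atTop_atTop (R := ℝ)).eventually_ge_atTop (12 / δ)).and
      (eventually_gt_atTop 0))).exists
  have hN' : (0 : ℝ) < N := by exact_mod_cast hN
  have hN6 : 12 ≤ N * δ := (div_le_iff₀ hδ).mp hN12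
  obtain ⟨p₁, lo₁, up₁, nn₁⟩ := logb_floor_bounds (mul_nonneg hN'.le h₁)
  obtain ⟨p₂, lo₂, up₂, nn₂⟩ := logb_floor_bounds (mul_nonneg hN'.le h₂)
  -- Default letters for extending the encoders beyond time N; block length N never reaches them.
  let i₁ : Inhabited X₁ := ⟨c.enc₁ ⟨0, p₁⟩ ⟨0, hN⟩⟩
  let i₂ : Inhabited X₂ := ⟨c.enc₂ ⟨0, p₂⟩ ⟨0, hN⟩ fun j => j.elim0⟩
  obtain ⟨P, hP, b₁, b₂⟩ := S.exists_inputLaw (encExt₁ c) (S.encYf c) N p₁ p₂ hN c.dec₁ c.dec₂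
  rw [← S.err₁_eq C c hS, ← S.err₂_eq C c hS] at b₁ b₂
  have u₁ := (mul_le_mul_of_nonneg_right ((le_max_left _ _).trans hc) nn₁).trans
    (mul_le_mul_of_nonneg_left up₁ hεpos.le)
  have u₂ := (mul_le_mul_of_nonneg_right ((le_max_right _ _).trans hc) nn₂).trans
    (mul_le_mul_of_nonneg_left up₂ hεpos.le)
  have v₁ : 0 ≤ ε * (N * R.1) := by positivity
  have v₂ : 0 ≤ ε * (N * R.2) := by positivity
  have v₃ : 0 ≤ ε * N := by positivity
  have v₄ : N * δ = 4 * (ε * (N * R.1)) + 4 * (ε * (N * R.2)) + 2 * (ε * N) := by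
    rw [← hεmul]; ring
  refine ⟨P, hP, le_of_mul_le_mul_left ?_ hN', le_of_mul_le_mul_left ?_ hN'⟩
  · calc (N : ℝ) * (2 * R.1 + R.2 - δ) = 2 * (N * R.1) + N * R.2 - N * δ := by ring
      _ ≤ N * S.bound₂₁ P := by linarith
  · calc (N : ℝ) * (R.1 + 2 * R.2 - δ) = N * R.1 + 2 * (N * R.2) - N * δ := by ring
      _ ≤ N * S.bound₁₂ P := by linarith

theorem exists_of_mem_capacityRegion (hS : S.Represents C) {R : ℝ × ℝ}
    (hR : R ∈ C.capacityRegion) {δ : ℝ} (hδ : 0 < δ) :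
    ∃ P ∈ stdSimplex ℝ (X₁ × X₂),
      2 * R.1 + R.2 - δ ≤ S.bound₂₁ P ∧ R.1 + 2 * R.2 - δ ≤ S.bound₁₂ P := by
  -- Either rate combination has total weight 3, so moving each rate by less than δ/6 costs less
  -- than δ/2; the other half is spent on R'.
  obtain ⟨R', ⟨h₁, h₂, hR'⟩, hd⟩ := Metric.mem_closure_iff.mp hR (δ / 6) (by linarith)
  obtain ⟨P, hP, b₁, b₂⟩ := exists_of_achievable hS h₁ h₂ hR' (half_pos hδ)
  rw [Prod.dist_eq, max_lt_iff, Real.dist_eq, Real.dist_eq, abs_lt, abs_lt] at hd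
  exact ⟨P, hP, by linarith, by linarith⟩

end Converse

end ISDModel

theorem theorem1 {X₁ X₂ YF Y₁ Y₂ Yf T₁ T₂ : Type*} [Fintype X₁] [Fintype X₂] [Fintype YF]
    [Fintype Y₁] [Fintype Y₂] [Fintype Yf] [Fintype T₁] [Fintype T₂]
    (C : MemorylessIC X₁ X₂ YF Y₁ Y₂) (S : ISDModel X₁ X₂ YF Y₁ Y₂ Yf T₁ T₂)
    (hS : S.Represents C) (R₁ R₂ : ℝ) (hR : (R₁, R₂) ∈ C.capacityRegion) :
    ∃ P ∈ stdSimplex ℝ (X₁ × X₂),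
      2 * R₁ + R₂ ≤ S.bound₂₁ P ∧ R₁ + 2 * R₂ ≤ S.bound₁₂ P := by
  -- Maximising the smaller of the two margins ensures that one distribution serves both
  -- inequalities.
  have hcont : ContinuousOn (fun P => min (S.bound₂₁ P - (2 * R₁ + R₂))
      (S.bound₁₂ P - (R₁ + 2 * R₂))) (stdSimplex ℝ (X₁ × X₂)) :=
    (S.continuousOn_bound₂₁.sub continuousOn_const).inf
      (S.continuousOn_bound₁₂.sub continuousOn_const)
  -- Used only to know that the simplex is nonempty; the slack 1 is arbitrary.
  obtain ⟨P₀, hP₀, -⟩ := ISDModel.exists_of_mem_capacityRegion hS hR one_pos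
  obtain ⟨P, hP, hmax⟩ := (isCompact_stdSimplex ℝ (X₁ × X₂)).exists_isMaxOn ⟨P₀, hP₀⟩ hcont
  have key : 0 ≤ min (S.bound₂₁ P - (2 * R₁ + R₂)) (S.bound₁₂ P - (R₁ + 2 * R₂)) := by
    refine le_of_forall_pos_sub_le fun δ hδ => ?_
    obtain ⟨P', hP', b₁, b₂⟩ := ISDModel.exists_of_mem_capacityRegion hS hR hδ
    refine le_trans (le_min ?_ ?_) (hmax hP') <;> linarith
  rw [le_min_iff, sub_nonneg, sub_nonneg] at key
  exact ⟨P, hP, key⟩
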